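/- Fix a field $\mathbb F$. A zigzag module of length $n\ge 1$ is a sequence $\mathbb V=(V_i,p_i)$ of finite-dimensional $\mathbb F$-vector spaces $V_1,\dots,V_n$ and linear maps $p_i$ ($1\le i<n$), each $p_i$ being either a map $V_i\to V_{i+1}$ or a map $V_i\leftarrow V_{i+1}$; the sequence $\tau\in\{\rightarrow,\leftarrow\}^{n-1}$ of directions is its type. Write $n\text{-Mod}$ for the class of all zigzag modules of length $n$. An isomorphism $\mathbb V\cong\mathbb W$ between modules of the same type is a family of linear isomorphisms $V_i\to W_i$ commuting with the structure maps; direct sums of modules of the same type are formed componentwise, and $\mathbb W\preceq\mathbb V$ means that $\mathbb V\cong\mathbb W\oplus\mathbb U$ for some $\mathbb U$. Write $\mathbb V\sim\mathbb W$ if, up to isomorphism, $\mathbb W$ is obtained from $\mathbb V$ by finitely many (possibly no) steps, each of which replaces a structure map that is an isomorphism by its inverse (reversing the arrow). Write $\mathbb W\precsim\mathbb V$ if $\mathbb W\sim\mathbb W'\preceq\mathbb V$ for some $\mathbb W'$. For $1\le b\le d\le n$ the interval module $\mathbb I_\tau([b,d])$ of type $\tau$ has the space $\mathbb F$ at the indices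 $b\le i\le d$ and $0$ elsewhere, with identity maps between neighbouring copies of $\mathbb F$ and zero maps otherwise. Every zigzag module of type $\tau$ is isomorphic to a finite direct sum of interval modules of type $\tau$, uniquely up to order; $\mathcal S(\mathbb V)$ denotes the direct sum of those summands $\mathbb I_\tau([b,d])$ of $\mathbb V$ with $b\ne d$. Define $$\mathbb V\sim_{\mathcal S}\mathbb W\iff \mathcal S(\mathbb V)\precsim\mathbb W\ \text{ and }\ \mathcal S(\mathbb W)\precsim\mathbb V .$$ For $1\le k\le n$ the extroversion reflection $\mathcal L_k$ replaces the part $V_{k-1}\leftrightarrow V_k\leftrightarrow V_{k+1}$ of $\mathbb V$ by $V_{k-1}\leftarrow L\rightarrow V_{k+1}$, where $L$ is the limit of that part together with its canonical maps, and the introversion reflection $\mathcal C_k$ replaces it by $V_{k-1}\rightarrow C\leftarrow V_{k+1}$, where $C$ is its colimit. At $k=1$ and at $k=n$ the missing neighbour is taken to be the zero space, joined to $V_k$ by a zero map whose direction may be chosen freely each time (each choice is a separate reflection), and the arrow to or from this zero space is discarded afterwards. For a finite sequence $\mathfrak R=(\mathcal R_\ell,\dots,\mathcal R_1)$ of reflections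 put $$\mathfrak R(\mathbb V)=(\mathcal S\circ\mathcal R_\ell\circ\mathcal S\circ\cdots\circ\mathcal S\circ\mathcal R_1\circ\mathcal S)(\mathbb V)$$ (so the empty sequence acts as $\mathcal S$), and for $p\in[1,\infty)$ let $C_p(\mathfrak R)=\ell^{1/p}$ if $\ell\ge 1$ and $C_p(\mathfrak R)=0$ if $\mathfrak R$ is empty. The $p$-reflection distance is $$d_{\mathcal R}^p(\mathbb V,\mathbb W)=\min\bigl\{\max\{C_p(\mathfrak R),C_p(\mathfrak R')\}\ :\ \mathfrak R(\mathbb V)\precsim\mathbb W,\ \mathfrak R'(\mathbb W)\precsim\mathbb V\bigr\},$$ the minimum being over all pairs $(\mathfrak R,\mathfrak R')$ of finite sequences of reflections with the stated property. **Theorem.** Let $n\ge 1$ and $p\in[1,\infty)$. For all $\mathbb V,\mathbb W\in n\text{-Mod}$ the minimum defining $d_{\mathcal R}^p(\mathbb V,\mathbb W)$ exists, and $d_{\mathcal R}^p$ is a (finite) pseudometric on $n\text{-Mod}$. Moreover, $d_{\mathcal R}^p(\mathbb V,\mathbb W)=0$ if and only if $\mathbb V\sim_{\mathcal S}\mathbb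 W$. The relation $\sim_{\mathcal S}$ is an equivalence relation, and $d_{\mathcal R}^p$ induces a metric on the quotient $n\text{-Mod}/{\sim_{\mathcal S}}$. -/

import Mathlib

universe u

/-- The two symbols `→` and `←`, giving the direction of an arrow read from left to right. -/
inductive Dir : Type
  | right
  | left

/-- An arrow `A ⟷ B` between two vector spaces: either a linear map `A → B` or a linear map
`A ← B`. -/
inductive ZArrow (F : Type u) [Field F] (A B : Type u) [AddCommGroup A] [Module F A]
    [AddCommGroup B] [Module F B] : Type u
  | fwd (f : A →ₗ[F] B) : ZArrow F A B
  | bwd (g : B →ₗ[F] A) : ZArrow F A B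

namespace ZArrow

variable {F : Type u} [Field F] {A B C A' B' : Type u}
  [AddCommGroup A] [Module F A] [AddCommGroup B] [Module F B] [AddCommGroup C] [Module F C]
  [AddCommGroup A'] [Module F A'] [AddCommGroup B'] [Module F B']

/-- The direction of an arrow. -/
def dir : ZArrow F A B → Dir
  | fwd _ => Dir.right
  | bwd _ => Dir.left

/-- The zero map in a prescribed direction. -/
def zero : Dir → ZArrow F A B
  | Dir.right => fwd 0
  | Dir.left => bwd 0

/-- The arrow represents an isomorphism. -/
def IsIso : ZArrow F A B → Prop
  | fwd f => Function.Bijective f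
  | bwd g => Function.Bijective g

/-- Replace an arrow that represents an isomorphism by its inverse, pointing the other way. -/
noncomputable def reverse : (a : ZArrow F A B) → a.IsIso → ZArrow F A B
  | fwd f, h => bwd (LinearEquiv.ofBijective f h).symm.toLinearMap
  | bwd g, h => fwd (LinearEquiv.ofBijective g h).symm.toLinearMap

/-- The square with horizontal arrows `A ⟷ B` and `A' ⟷ B'` and vertical maps `φ`, `ψ` commutes;
the two arrows have to point in the same direction. -/
def Commutes (φ : A →ₗ[F] A') (ψ : B →ₗ[F] B') : ZArrow F A B → ZArrow F A' B' → Prop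
  | fwd f, fwd f' => ψ ∘ₗ f = f' ∘ₗ φ
  | bwd g, bwd g' => φ ∘ₗ g = g' ∘ₗ ψ
  | _, _ => False

/-- The direct sum of two arrows pointing in the same direction (the zero map otherwise; this case
is never used). -/
def directSum : ZArrow F A B → ZArrow F A' B' → ZArrow F (A × A') (B × B')
  | fwd f, fwd f' => fwd (f.prodMap f')
  | bwd g, bwd g' => bwd (g.prodMap g')
  | _, _ => fwd 0

/-- The pairs `(x, y)` such that one of `x`, `y` is mapped to the other by the arrow. -/
def graph : ZArrow F A B → Submodule F (A × B)
  | fwd f => LinearMap.eqLocus (f ∘ₗ LinearMap.fst F A B) (LinearMap.snd F A B)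
  | bwd g => LinearMap.eqLocus (g ∘ₗ LinearMap.snd F A B) (LinearMap.fst F A B)

/-- The limit of a diagram `A ⟷ B ⟷ C`: the compatible triples `(x, y, z)`, with the three
coordinate projections as limit cone. -/
def limit (a : ZArrow F A B) (b : ZArrow F B C) : Submodule F (A × B × C) :=
  a.graph.comap (LinearMap.prodMap LinearMap.id (LinearMap.fst F B C)) ⊓
    b.graph.comap (LinearMap.snd F A (B × C))

/-- The subspace of `A ⊕ B ⊕ C` spanned by the vectors `(x, -y, 0)` with `x`, `y` related by the
first arrow and the vectors `(0, y, -z)` with `y`, `z` related by the second one. -/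
def colimitRel (a : ZArrow F A B) (b : ZArrow F B C) : Submodule F (A × B × C) :=
  a.graph.map (LinearMap.prodMap LinearMap.id (-LinearMap.inl F B C)) ⊔
    b.graph.map (LinearMap.inr F A (B × C) ∘ₗ LinearMap.prodMap LinearMap.id (-LinearMap.id))

/-- The colimit of a diagram `A ⟷ B ⟷ C`, a quotient of `A ⊕ B ⊕ C`, with the classes of the
three coordinate inclusions as colimit cocone. -/
abbrev colimit (a : ZArrow F A B) (b : ZArrow F B C) : Type u :=
  (A × B × C) ⧸ colimitRel a b

end ZArrow

/-- A zigzag module of length `n + 1` over the field `F`: finite-dimensional vector spaces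
`V₀, …, Vₙ` together with an arrow `Vᵢ ⟷ Vᵢ₊₁` in one of the two directions for each `i < n`. -/
structure ZigzagModule (F : Type u) [Field F] (n : ℕ) : Type (u + 1) where
  /-- the vector spaces -/
  space : Fin (n + 1) → FGModuleCat.{u} F
  /-- the structure maps -/
  arrow : ∀ i : Fin n, ZArrow F (space i.castSucc) (space i.succ)

/-- The intervals `[b, d]` of `{0, …, n}`, `b ≤ d`. -/
abbrev Bar (n : ℕ) : Type := {I : Fin (n + 1) × Fin (n + 1) // I.1 ≤ I.2}

/-- A reflection functor on zigzag modules of length `n + 1`: it is placed at an index, it is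
extroversion (limit) or introversion (colimit), and for the two extreme indices it also depends on
the choice of a direction (for the other indices that direction plays no role). -/
inductive Reflection (n : ℕ) : Type
  | extro (k : Fin (n + 1)) (c : Dir) : Reflection n
  | intro (k : Fin (n + 1)) (c : Dir) : Reflection n

namespace ZigzagModule

variable {F : Type u} [Field F] {n : ℕ}

/-- The type of a zigzag module. -/
def type (V : ZigzagModule F n) : Fin n → Dir := fun i => (V.arrow i).dir

/-- `V ≅ W`: there is a morphism from `V` to `W` all of whose components are bijective. In
particular `V` and `W` have the same type. -/
def Isomorphic (V W : ZigzagModule F n) : Prop :=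
  ∃ e : ∀ i, V.space i ≃ₗ[F] W.space i, ∀ i : Fin n,
    ZArrow.Commutes (e i.castSucc).toLinearMap (e i.succ).toLinearMap (V.arrow i) (W.arrow i)

/-- The zero module of type `τ`. -/
def zeroModule (F : Type u) [Field F] {n : ℕ} (τ : Fin n → Dir) : ZigzagModule F n where
  space _ := FGModuleCat.of F PUnit.{u + 1}
  arrow i := ZArrow.zero (τ i)

/-- The direct sum of two zigzag modules (of the same type). -/
def directSum (V W : ZigzagModule F n) : ZigzagModule F n where
  space i := FGModuleCat.of F (V.space i × W.space i)
  arrow i := (V.arrow i).directSum (W.arrow i)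

/-- `W ⪯ V`: the module `W` is a summand of `V`. -/
def IsSummand (W V : ZigzagModule F n) : Prop :=
  ∃ U : ZigzagModule F n, U.type = W.type ∧ Isomorphic V (directSum W U)

section Interval

/-- The vector space of an interval module at the index `i`: it is `F` if `b ≤ i ≤ d` and `0`
otherwise (as a subspace of `F`). -/
noncomputable def intervalSpace (F : Type u) [Field F] {n : ℕ} (I : Bar n) (i : Fin (n + 1)) :
    Submodule F F :=
  if I.1.1 ≤ i ∧ i ≤ I.1.2 then ⊤ else ⊥

open Classical in
/-- The map between two subspaces of `F` that is the inclusion if there is one and zero otherwise.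
For the subspaces `0` and `F` this is the identity `F → F` and zero in the other three cases. -/
noncomputable def inclusionOrZero (P Q : Submodule F F) : P →ₗ[F] Q :=
  if h : P ≤ Q then Submodule.inclusion h else 0

/-- The structure maps of an interval module. -/
noncomputable def intervalArrow (P Q : Submodule F F) : Dir → ZArrow F P Q
  | Dir.right => ZArrow.fwd (inclusionOrZero P Q)
  | Dir.left => ZArrow.bwd (inclusionOrZero Q P)

/-- The interval module of type `τ` on `[b, d]`. -/
noncomputable def intervalModule (F : Type u) [Field F] {n : ℕ} (τ : Fin n → Dir) (I : Bar n) :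
    ZigzagModule F n where
  space i := FGModuleCat.of F (intervalSpace F I i)
  arrow i := intervalArrow (intervalSpace F I i.castSucc) (intervalSpace F I i.succ) (τ i)

/-- The direct sum of the interval modules of type `τ` on the members of a finite list. -/
noncomputable def intervalSum (F : Type u) [Field F] {n : ℕ} (τ : Fin n → Dir) :
    List (Bar n) → ZigzagModule F n
  | [] => zeroModule F τ
  | I :: D => directSum (intervalModule F τ I) (intervalSum F τ D)

end Interval

open Classical in
/-- The persistence diagram of `V`: the multiset of intervals in a decomposition of `V` as a direct
sum of interval modules. -/
noncomputable def dgm (V : ZigzagModule F n) : Multiset (Bar n) :=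
  if h : ∃ D : List (Bar n), Isomorphic V (intervalSum F V.type D) then
    (h.choose : Multiset (Bar n))
  else 0

/-- The map `𝒮`, which removes the simple summands: it keeps the intervals `[b, d]` of the
decomposition with `b ≠ d`. -/
noncomputable def removeSimple (V : ZigzagModule F n) : ZigzagModule F n :=
  intervalSum F V.type (V.dgm.filter fun I => I.1.1 ≠ I.1.2).toList

/-- The arrow reversal at index `k`, for a module whose `k`-th structure map is an isomorphism. -/
noncomputable def reverseArrow (V : ZigzagModule F n) (k : Fin n) (h : (V.arrow k).IsIso) :
    ZigzagModule F n where
  space := V.space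
  arrow := Function.update V.arrow k ((V.arrow k).reverse h)

/-- `V ∼ W`: up to isomorphism, `W` is obtained from `V` by finitely many (possibly no) arrow
reversals. -/
def Equivalent (V W : ZigzagModule F n) : Prop :=
  ∃ V' : ZigzagModule F n,
    Relation.ReflTransGen
      (fun X Y : ZigzagModule F n => ∃ k, ∃ h : (X.arrow k).IsIso, Y = X.reverseArrow k h) V V' ∧
    Isomorphic V' W

/-- `W ≾ V`: the module `W` is equivalent to a summand of `V`. -/
def Precsim (W V : ZigzagModule F n) : Prop :=
  ∃ W' : ZigzagModule F n, Equivalent W W' ∧ IsSummand W' V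

/-- The relation `V ∼_𝒮 W`. -/
def SimS (V W : ZigzagModule F n) : Prop :=
  Precsim V.removeSimple W ∧ Precsim W.removeSimple V

section Reflections

/-- The part `Vₖ₋₁ ⟷ Vₖ` of `V`, to be read as `0 ⟷ V₀`, with the zero map in direction `c`, if
`k` is the first index. -/
noncomputable def leftNbr (V : ZigzagModule F n) (c : Dir) (k : Fin (n + 1)) :
    Σ A : FGModuleCat.{u} F, ZArrow F A (V.space k) :=
  Fin.cases (motive := fun k => Σ A : FGModuleCat.{u} F, ZArrow F A (V.space k))
    ⟨FGModuleCat.of F PUnit.{u + 1}, ZArrow.zero c⟩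
    (fun i => ⟨V.space i.castSucc, V.arrow i⟩) k

/-- The part `Vₖ ⟷ Vₖ₊₁` of `V`, to be read as `Vₙ ⟷ 0`, with the zero map in direction `c`, if
`k` is the last index. -/
noncomputable def rightNbr (V : ZigzagModule F n) (c : Dir) (k : Fin (n + 1)) :
    Σ B : FGModuleCat.{u} F, ZArrow F (V.space k) B :=
  Fin.lastCases (motive := fun k => Σ B : FGModuleCat.{u} F, ZArrow F (V.space k) B)
    ⟨FGModuleCat.of F PUnit.{u + 1}, ZArrow.zero c⟩
    (fun i => ⟨V.space i.succ, V.arrow i⟩) k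

theorem leftNbr_succ (V : ZigzagModule F n) (c : Dir) (i : Fin n) :
    V.leftNbr c i.succ = ⟨V.space i.castSucc, V.arrow i⟩ := by
  simp [leftNbr]

theorem rightNbr_castSucc (V : ZigzagModule F n) (c : Dir) (i : Fin n) :
    V.rightNbr c i.castSucc = ⟨V.space i.succ, V.arrow i⟩ := by
  simp [rightNbr]

/-- The identification of two equal vector spaces. -/
noncomputable def castEquiv {A B : FGModuleCat.{u} F} (h : A = B) : A ≃ₗ[F] B := by
  subst h; exact LinearEquiv.refl F A

/-- The left neighbour of the index `i + 1` is `Vᵢ`. -/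
noncomputable def leftEquiv (V : ZigzagModule F n) (c : Dir) (i : Fin n) :
    (V.leftNbr c i.succ).1 ≃ₗ[F] V.space i.castSucc :=
  castEquiv (congrArg Sigma.fst (V.leftNbr_succ c i))

/-- The right neighbour of the index `i` is `Vᵢ₊₁`. -/
noncomputable def rightEquiv (V : ZigzagModule F n) (c : Dir) (i : Fin n) :
    (V.rightNbr c i.castSucc).1 ≃ₗ[F] V.space i.succ :=
  castEquiv (congrArg Sigma.fst (V.rightNbr_castSucc c i))

/-- The limit of the diagram `Vₖ₋₁ ⟷ Vₖ ⟷ Vₖ₊₁`. -/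
noncomputable def limitAt (V : ZigzagModule F n) (c : Dir) (k : Fin (n + 1)) : FGModuleCat.{u} F :=
  FGModuleCat.of F (ZArrow.limit (V.leftNbr c k).2 (V.rightNbr c k).2)

/-- The leg of the limit cone at index `i + 1` with target `Vᵢ`. -/
noncomputable def limitToLeft (V : ZigzagModule F n) (c : Dir) (i : Fin n) :
    V.limitAt c i.succ →ₗ[F] V.space i.castSucc :=
  (V.leftEquiv c i).toLinearMap ∘ₗ LinearMap.fst F _ _ ∘ₗ
    (ZArrow.limit (V.leftNbr c i.succ).2 (V.rightNbr c i.succ).2).subtype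

/-- The leg of the limit cone at index `i` with target `Vᵢ₊₁`. -/
noncomputable def limitToRight (V : ZigzagModule F n) (c : Dir) (i : Fin n) :
    V.limitAt c i.castSucc →ₗ[F] V.space i.succ :=
  (V.rightEquiv c i).toLinearMap ∘ₗ LinearMap.snd F _ _ ∘ₗ LinearMap.snd F _ _ ∘ₗ
    (ZArrow.limit (V.leftNbr c i.castSucc).2 (V.rightNbr c i.castSucc).2).subtype

/-- The colimit of the diagram `Vₖ₋₁ ⟷ Vₖ ⟷ Vₖ₊₁`. -/
noncomputable def colimitAt (V : ZigzagModule F n) (c : Dir) (k : Fin (n + 1)) :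
    FGModuleCat.{u} F :=
  FGModuleCat.of F (ZArrow.colimit (V.leftNbr c k).2 (V.rightNbr c k).2)

/-- The leg of the colimit cocone at index `i + 1` with source `Vᵢ`. -/
noncomputable def colimitFromLeft (V : ZigzagModule F n) (c : Dir) (i : Fin n) :
    V.space i.castSucc →ₗ[F] V.colimitAt c i.succ :=
  (ZArrow.colimitRel (V.leftNbr c i.succ).2 (V.rightNbr c i.succ).2).mkQ ∘ₗ
    LinearMap.inl F _ _ ∘ₗ (V.leftEquiv c i).symm.toLinearMap

/-- The leg of the colimit cocone at index `i` with source `Vᵢ₊₁`. -/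
noncomputable def colimitFromRight (V : ZigzagModule F n) (c : Dir) (i : Fin n) :
    V.space i.succ →ₗ[F] V.colimitAt c i.castSucc :=
  (ZArrow.colimitRel (V.leftNbr c i.castSucc).2 (V.rightNbr c i.castSucc).2).mkQ ∘ₗ
    LinearMap.inr F _ _ ∘ₗ LinearMap.inr F _ _ ∘ₗ (V.rightEquiv c i).symm.toLinearMap

/-- The space at index `i` after extroversion at `k`; the Boolean argument says
whether `i = k`. -/
noncomputable def extroSpace (V : ZigzagModule F n) (c : Dir) (i : Fin (n + 1)) :
    Bool → FGModuleCat.{u} F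
  | true => V.limitAt c i
  | false => V.space i

/-- The arrow between the indices `i` and `i + 1` after extroversion at `k`; the two Boolean
arguments say whether `i = k` and whether `i + 1 = k` (they are never both true). -/
noncomputable def extroArrow (V : ZigzagModule F n) (c : Dir) (i : Fin n) :
    (s t : Bool) → ZArrow F (V.extroSpace c i.castSucc s) (V.extroSpace c i.succ t)
  | false, false => V.arrow i
  | true, false => ZArrow.fwd (V.limitToRight c i)
  | false, true => ZArrow.bwd (V.limitToLeft c i)
  | true, true => ZArrow.fwd 0

/-- The extroversion reflection `ℒₖ`: `Vₖ` is replaced by the limit of `Vₖ₋₁ ⟷ Vₖ ⟷ Vₖ₊₁`. -/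
noncomputable def extroversion (k : Fin (n + 1)) (c : Dir) (V : ZigzagModule F n) :
    ZigzagModule F n where
  space i := V.extroSpace c i (decide (i = k))
  arrow i := V.extroArrow c i (decide (i.castSucc = k)) (decide (i.succ = k))

/-- The space at index `i` after introversion at `k`; the Boolean argument says
whether `i = k`. -/
noncomputable def introSpace (V : ZigzagModule F n) (c : Dir) (i : Fin (n + 1)) :
    Bool → FGModuleCat.{u} F
  | true => V.colimitAt c i
  | false => V.space i

/-- The arrow between the indices `i` and `i + 1` after introversion at `k`; the two Boolean
arguments say whether `i = k` and whether `i + 1 = k` (they are never both true). -/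
noncomputable def introArrow (V : ZigzagModule F n) (c : Dir) (i : Fin n) :
    (s t : Bool) → ZArrow F (V.introSpace c i.castSucc s) (V.introSpace c i.succ t)
  | false, false => V.arrow i
  | true, false => ZArrow.bwd (V.colimitFromRight c i)
  | false, true => ZArrow.fwd (V.colimitFromLeft c i)
  | true, true => ZArrow.fwd 0

/-- The introversion reflection `𝒞ₖ`: `Vₖ` is replaced by the colimit of `Vₖ₋₁ ⟷ Vₖ ⟷ Vₖ₊₁`. -/
noncomputable def introversion (k : Fin (n + 1)) (c : Dir) (V : ZigzagModule F n) :
    ZigzagModule F n where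
  space i := V.introSpace c i (decide (i = k))
  arrow i := V.introArrow c i (decide (i.castSucc = k)) (decide (i.succ = k))

/-- The action of a reflection functor on zigzag modules. -/
noncomputable def reflect : Reflection n → ZigzagModule F n → ZigzagModule F n
  | Reflection.extro k c, V => V.extroversion k c
  | Reflection.intro k c, V => V.introversion k c

/-- The action of a finite sequence of reflection functors (the head of the list is applied first),
where simple summands are removed at the beginning and after each reflection. -/
noncomputable def applySeq (R : List (Reflection n)) (V : ZigzagModule F n) : ZigzagModule F n :=
  R.foldl (fun X r => (reflect r X).removeSimple) V.removeSimple

end Reflections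

/-- The `p`-cost of a sequence of `ℓ` reflections. -/
noncomputable def seqCost (p : ℝ) (ℓ : ℕ) : ℝ :=
  if ℓ = 0 then 0 else (ℓ : ℝ) ^ (1 / p)

/-- The costs of the pairs of sequences of reflections which carry `V`, up to equivalence, to a
summand of `W`, and `W` to a summand of `V`. -/
def costSet (p : ℝ) (V W : ZigzagModule F n) : Set ℝ :=
  {t | ∃ R R' : List (Reflection n), Precsim (applySeq R V) W ∧ Precsim (applySeq R' W) V ∧
    t = max (seqCost p R.length) (seqCost p R'.length)}

/-- The `p`-reflection distance. -/
noncomputable def reflectionDist (p : ℝ) (V W : ZigzagModule F n) : ℝ :=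
  sInf (costSet p V W)

end ZigzagModule

/-!
The argument never computes a reflection of an interval module. A structure map is replaced by its
graph, a linear relation between neighbouring spaces. Reversing an isomorphism does not change its
graph, and limits and colimits depend on the graphs only. A direct summand of the graph of a map
`A → B` that is at the same time the graph of a map `B → A` is the graph of an isomorphism. Hence
`W ≾ V` holds if and only if there are a module `U` and isomorphisms `Vᵢ ≃ Wᵢ × Uᵢ` identifying the
graphs of `V` with the products of the graphs of `W` and `U`, whatever the types of the three modules
are (`ZigzagModule.precsim_iff`). In this form transitivity of `≾` is easy, and every reflection
preserves `≾` because it commutes with direct sums (`ZigzagModule.Precsim.reflect`).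

The map `𝒮` requires the decomposition into interval modules. For existence, an interval starting at
the first nonzero space is split off (`ZigzagModule.exists_intervalModule_summand`). For uniqueness,
the number of intervals containing a given one is a rank, defined by sections, which is additive and
depends on the graphs only (`ZigzagModule.barRank`). It follows that the diagram of a direct sum up
to reversal is the sum of the diagrams, that an arrow which is an isomorphism cuts no interval, and
that `𝒮` preserves `≾` (`ZigzagModule.Precsim.removeSimple`).

So sequences of reflections are monotone for `≾` and can be concatenated
(`ZigzagModule.Precsim.applySeq_append`), and subadditivity of `t ↦ t ^ (1 / p)` gives the triangle
inequality. Admissible sequences exist since every module is annihilated by some sequence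
(`ZigzagModule.exists_applySeq_subsingleton`). The minimum is attained because the cost is a monotone
function of a natural number, and the distance is zero exactly if both optimal sequences are empty,
which is the relation `∼_𝒮`. That this is an equivalence relation is then a consequence of the axioms
of a pseudometric.
-/

/-! ### Arrows as linear relations -/

namespace ZArrow

variable {F : Type u} [Field F] {A B A' B' A₁ B₁ A₂ B₂ : Type u}
  [AddCommGroup A] [Module F A] [AddCommGroup B] [Module F B]
  [AddCommGroup A'] [Module F A'] [AddCommGroup B'] [Module F B']
  [AddCommGroup A₁] [Module F A₁] [AddCommGroup B₁] [Module F B₁]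
  [AddCommGroup A₂] [Module F A₂] [AddCommGroup B₂] [Module F B₂]

@[simp]
theorem mem_graph_fwd (f : A →ₗ[F] B) (x : A) (y : B) : (x, y) ∈ (fwd f).graph ↔ f x = y := by
  simp [graph]

@[simp]
theorem mem_graph_bwd (g : B →ₗ[F] A) (x : A) (y : B) :
    (x, y) ∈ (bwd g : ZArrow F A B).graph ↔ g y = x := by
  simp [graph]

theorem zero_mem_graph (a : ZArrow F A B) : ((0 : A), (0 : B)) ∈ a.graph := a.graph.zero_mem

theorem dir_reverse (a : ZArrow F A B) (h : a.IsIso) : (a.reverse h).dir ≠ a.dir := by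
  cases a <;> simp [reverse, dir]

/-- An arrow and its reversal are the same linear relation. -/
theorem graph_reverse (a : ZArrow F A B) (h : a.IsIso) (x : A) (y : B) :
    (x, y) ∈ (a.reverse h).graph ↔ (x, y) ∈ a.graph := by
  cases a with
  | fwd f =>
    simp only [reverse, mem_graph_bwd, mem_graph_fwd, LinearEquiv.coe_coe]
    rw [LinearEquiv.symm_apply_eq]
    exact eq_comm
  | bwd g =>
    simp only [reverse, mem_graph_bwd, mem_graph_fwd, LinearEquiv.coe_coe]
    rw [LinearEquiv.symm_apply_eq]
    exact eq_comm

theorem commutes_iff (e : A ≃ₗ[F] A') (e' : B ≃ₗ[F] B') (a : ZArrow F A B) (a' : ZArrow F A' B') :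
    Commutes e.toLinearMap e'.toLinearMap a a' ↔
      a.dir = a'.dir ∧ ∀ x y, (x, y) ∈ a.graph ↔ (e x, e' y) ∈ a'.graph := by
  cases a with
  | fwd f =>
    cases a' with
    | fwd f' =>
      simp only [Commutes, dir, mem_graph_fwd, true_and, LinearMap.ext_iff, LinearMap.comp_apply,
        LinearEquiv.coe_coe]
      constructor
      · intro h x y
        rw [← h, e'.injective.eq_iff]
      · intro h x
        exact ((h x _).1 rfl).symm
    | bwd f' => simp [Commutes, dir]
  | bwd f =>
    cases a' with
    | fwd f' => simp [Commutes, dir]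
    | bwd f' =>
      simp only [Commutes, dir, mem_graph_bwd, true_and, LinearMap.ext_iff, LinearMap.comp_apply,
        LinearEquiv.coe_coe]
      constructor
      · intro h x y
        rw [← h, e.injective.eq_iff]
      · intro h x
        exact ((h _ x).1 rfl).symm

theorem mem_graph_directSum {a : ZArrow F A₁ B₁} {b : ZArrow F A₂ B₂} (h : a.dir = b.dir)
    (x : A₁ × A₂) (y : B₁ × B₂) :
    (x, y) ∈ (a.directSum b).graph ↔ (x.1, y.1) ∈ a.graph ∧ (x.2, y.2) ∈ b.graph := by
  cases a <;> cases b <;> first | (simp [dir] at h; done) | simp [directSum, Prod.ext_iff]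

theorem dir_directSum {a : ZArrow F A₁ B₁} {b : ZArrow F A₂ B₂} (h : a.dir = b.dir) :
    (a.directSum b).dir = a.dir := by
  cases a <;> cases b <;> first | (simp [dir] at h; done) | rfl

/-- The isomorphisms `eA : A ≃ A₁ × A₂` and `eB : B ≃ B₁ × B₂` identify the graph of `a` with the
product of the graphs of `a₁` and `a₂`. The directions of the three arrows may differ. -/
def SumCompat (eA : A ≃ₗ[F] A₁ × A₂) (eB : B ≃ₗ[F] B₁ × B₂) (a : ZArrow F A B)
    (a₁ : ZArrow F A₁ B₁) (a₂ : ZArrow F A₂ B₂) : Prop :=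
  ∀ x y, (x, y) ∈ a.graph ↔ ((eA x).1, (eB y).1) ∈ a₁.graph ∧ ((eA x).2, (eB y).2) ∈ a₂.graph

theorem SumCompat.swap {eA : A ≃ₗ[F] A₁ × A₂} {eB : B ≃ₗ[F] B₁ × B₂} {a : ZArrow F A B}
    {a₁ : ZArrow F A₁ B₁} {a₂ : ZArrow F A₂ B₂} (h : SumCompat eA eB a a₁ a₂) :
    SumCompat (eA.trans (LinearEquiv.prodComm F A₁ A₂)) (eB.trans (LinearEquiv.prodComm F B₁ B₂))
      a a₂ a₁ := by
  intro x y
  rw [h x y, and_comm]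
  rfl

/-- A map pointing in one direction whose graph is a direct summand of the graph of a map pointing in
the other direction is an isomorphism. -/
theorem SumCompat.isIso_left {eA : A ≃ₗ[F] A₁ × A₂} {eB : B ≃ₗ[F] B₁ × B₂} {a : ZArrow F A B}
    {a₁ : ZArrow F A₁ B₁} {a₂ : ZArrow F A₂ B₂} (h : SumCompat eA eB a a₁ a₂)
    (hd : a₁.dir ≠ a.dir) : a₁.IsIso := by
  cases a with
  | fwd f =>
    cases a₁ with
    | fwd f₁ => exact absurd rfl hd
    | bwd g =>
      refine ⟨(injective_iff_map_eq_zero g).2 fun w hw => ?_, fun x => ?_⟩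
      · have := (h 0 (eB.symm (w, 0))).2 (by simp [hw, zero_mem_graph])
        have h0 : eB.symm (w, 0) = 0 := by simpa using this.symm
        simpa using h0
      · have := ((h (eA.symm (x, 0)) _).1 ((mem_graph_fwd _ _ _).2 rfl)).1
        exact ⟨_, by simpa using this⟩
  | bwd g =>
    cases a₁ with
    | bwd f₁ => exact absurd rfl hd
    | fwd f =>
      refine ⟨(injective_iff_map_eq_zero f).2 fun w hw => ?_, fun x => ?_⟩
      · have := (h (eA.symm (w, 0)) 0).2 (by simp [hw, zero_mem_graph])
        have h0 : eA.symm (w, 0) = 0 := by simpa using this.symm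
        simpa using h0
      · have := ((h _ (eB.symm (x, 0))).1 ((mem_graph_bwd _ _ _).2 rfl)).1
        exact ⟨_, by simpa using this⟩

end ZArrow

/-! ### Isomorphisms up to arrow reversal and direct sums up to arrow reversal -/

namespace ZigzagModule

variable {F : Type u} [Field F] {n : ℕ}

/-- Isomorphisms `Vᵢ ≃ Wᵢ` exist that identify the graphs of the structure maps, regardless of
their directions. -/
def GraphIso (V W : ZigzagModule F n) : Prop :=
  ∃ e : ∀ i, V.space i ≃ₗ[F] W.space i, ∀ (i : Fin n) (x : V.space i.castSucc) (y : V.space i.succ),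
    (x, y) ∈ (V.arrow i).graph ↔ (e _ x, e _ y) ∈ (W.arrow i).graph

/-- `V` is the direct sum of `W` and `U` up to arrow reversal: isomorphisms `Vᵢ ≃ Wᵢ × Uᵢ` exist
that identify the graph of each structure map of `V` with the product of those of `W` and `U`,
regardless of the directions. -/
def IsGraphSum (V W U : ZigzagModule F n) : Prop :=
  ∃ e : ∀ i, V.space i ≃ₗ[F] (W.space i × U.space i), ∀ i : Fin n,
    ZArrow.SumCompat (e i.castSucc) (e i.succ) (V.arrow i) (W.arrow i) (U.arrow i)

theorem GraphIso.refl (V : ZigzagModule F n) : GraphIso V V :=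
  ⟨fun _ => LinearEquiv.refl F _, fun _ _ _ => Iff.rfl⟩

theorem GraphIso.symm {V W : ZigzagModule F n} : GraphIso V W → GraphIso W V := by
  rintro ⟨e, he⟩
  refine ⟨fun i => (e i).symm, fun i x y => ?_⟩
  rw [he]
  simp

theorem GraphIso.trans {V W U : ZigzagModule F n} :
    GraphIso V W → GraphIso W U → GraphIso V U := by
  rintro ⟨e, he⟩ ⟨e', he'⟩
  exact ⟨fun i => (e i).trans (e' i), fun i x y => (he i x y).trans (he' i _ _)⟩

theorem isomorphic_iff {V W : ZigzagModule F n} :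
    Isomorphic V W ↔ V.type = W.type ∧ GraphIso V W := by
  constructor
  · rintro ⟨e, he⟩
    exact ⟨funext fun i => ((ZArrow.commutes_iff _ _ _ _).1 (he i)).1,
      e, fun i => ((ZArrow.commutes_iff _ _ _ _).1 (he i)).2⟩
  · rintro ⟨ht, e, he⟩
    exact ⟨e, fun i => (ZArrow.commutes_iff _ _ _ _).2 ⟨congrFun ht i, he i⟩⟩

theorem IsGraphSum.swap {V W U : ZigzagModule F n} : IsGraphSum V W U → IsGraphSum V U W := by
  rintro ⟨e, he⟩
  exact ⟨fun i => (e i).trans (LinearEquiv.prodComm F _ _), fun i => (he i).swap⟩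

theorem IsGraphSum.congr_left {V V' W U : ZigzagModule F n} (h : GraphIso V V') :
    IsGraphSum V W U → IsGraphSum V' W U := by
  rintro ⟨e, he⟩
  obtain ⟨f, hf⟩ := h.symm
  exact ⟨fun i => (f i).trans (e i), fun i x y => (hf i x y).trans (he i _ _)⟩

theorem IsGraphSum.congr_mid {V W W' U : ZigzagModule F n} (h : GraphIso W W') :
    IsGraphSum V W U → IsGraphSum V W' U := by
  rintro ⟨e, he⟩
  obtain ⟨f, hf⟩ := h
  exact ⟨fun i => (e i).trans ((f i).prodCongr (LinearEquiv.refl F _)),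
    fun i x y => (he i x y).trans (and_congr (hf i _ _) Iff.rfl)⟩

theorem IsGraphSum.congr_right {V W U U' : ZigzagModule F n} (h : GraphIso U U')
    (hs : IsGraphSum V W U) : IsGraphSum V W U' :=
  (hs.swap.congr_mid h).swap

theorem IsGraphSum.graphIso {V V' W U : ZigzagModule F n} :
    IsGraphSum V W U → IsGraphSum V' W U → GraphIso V V' := by
  rintro ⟨e, he⟩ ⟨e', he'⟩
  refine ⟨fun i => (e i).trans (e' i).symm, fun i x y => ?_⟩
  rw [he i x y, he' i]
  simp

theorem isGraphSum_directSum {V W : ZigzagModule F n} (h : V.type = W.type) :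
    IsGraphSum (directSum V W) V W :=
  ⟨fun _ => LinearEquiv.refl F _, fun i x y =>
    ZArrow.mem_graph_directSum (congrFun h i) x y⟩

theorem type_directSum {V W : ZigzagModule F n} (h : V.type = W.type) :
    (directSum V W).type = V.type :=
  funext fun i => ZArrow.dir_directSum (congrFun h i)

theorem IsGraphSum.isIso_left {V W U : ZigzagModule F n} (h : IsGraphSum V W U) {i : Fin n}
    (hd : W.type i ≠ V.type i) : (W.arrow i).IsIso := by
  obtain ⟨e, he⟩ := h
  exact (he i).isIso_left hd

/-- Adding a zero module does not change anything, so statements about `IsGraphSum` specialise to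
statements about `GraphIso`. -/
theorem graphIso_iff_isGraphSum {V W U : ZigzagModule F n} (hU : ∀ i, Subsingleton (U.space i)) :
    GraphIso V W ↔ IsGraphSum V W U := by
  have h0 : ∀ (i : Fin n) (x : U.space i.castSucc) (y : U.space i.succ),
      (x, y) ∈ (U.arrow i).graph := fun i x y => by
    have h1 := hU i.castSucc
    have h2 := hU i.succ
    rw [Subsingleton.elim x 0, Subsingleton.elim y 0]
    exact ZArrow.zero_mem_graph _
  constructor
  · rintro ⟨e, he⟩
    refine ⟨fun i => LinearEquiv.ofBijective
      (LinearMap.prod (e i).toLinearMap 0) ⟨?_, ?_⟩, fun i x y => ?_⟩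
    · intro x y h
      exact (e i).injective (congrArg Prod.fst h)
    · rintro ⟨x, y⟩
      have := hU i
      exact ⟨(e i).symm x, Prod.ext (by simp) (Subsingleton.elim _ _)⟩
    · exact (he i x y).trans (and_iff_left (h0 i _ _)).symm
  · rintro ⟨e, he⟩
    refine ⟨fun i => LinearEquiv.ofBijective (LinearMap.fst F _ _ ∘ₗ (e i).toLinearMap)
      ⟨?_, ?_⟩, fun i x y => ?_⟩
    · intro x y h
      have := hU i
      exact (e i).injective (Prod.ext h (Subsingleton.elim _ _))
    · intro x
      exact ⟨(e i).symm (x, 0), by simp⟩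
    · exact (he i x y).trans (and_iff_left (h0 i _ _))

/-! ### Equivalence and the preorder in terms of graphs -/

theorem graphIso_reverseArrow (V : ZigzagModule F n) (k : Fin n) (h : (V.arrow k).IsIso) :
    GraphIso V (V.reverseArrow k h) := by
  refine ⟨fun i => LinearEquiv.refl F _, fun i x y => ?_⟩
  by_cases hi : i = k
  · subst hi
    simp only [reverseArrow, Function.update_self]
    exact (ZArrow.graph_reverse _ h x y).symm
  · simp only [reverseArrow, Function.update_of_ne hi]
    rfl

theorem type_reverseArrow_ne (V : ZigzagModule F n) (k : Fin n) (h : (V.arrow k).IsIso)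
    {i : Fin n} (hi : i ≠ k) : (V.reverseArrow k h).type i = V.type i := by
  simp only [type, reverseArrow, Function.update_of_ne hi]
  rfl

theorem type_reverseArrow_self (V : ZigzagModule F n) (k : Fin n) (h : (V.arrow k).IsIso) :
    (V.reverseArrow k h).type k ≠ V.type k := by
  simp only [type, reverseArrow, Function.update_self]
  exact ZArrow.dir_reverse _ h

/-- If a structure map is an isomorphism, then so are its summands: if the directions agree, reverse
the structure map first. -/
theorem IsGraphSum.isIso_of_isIso {V W U : ZigzagModule F n} (h : IsGraphSum V W U) {i : Fin n}
    (hi : (V.arrow i).IsIso) : (W.arrow i).IsIso := by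
  by_cases hd : W.type i = V.type i
  · refine (h.congr_left (V.graphIso_reverseArrow i hi)).isIso_left fun h' => ?_
    exact V.type_reverseArrow_self i hi (h'.symm.trans hd)
  · exact h.isIso_left hd

theorem _root_.Dir.eq_of_ne_of_ne {a b c : Dir} (h : a ≠ b) (h' : c ≠ b) : a = c := by
  cases a <;> cases b <;> cases c <;> simp_all

/-- If all structure maps whose direction differs from the one prescribed by `τ` are isomorphisms,
then the module can be brought to type `τ` by arrow reversals. -/
theorem exists_retype (V : ZigzagModule F n) (τ : Fin n → Dir)
    (h : ∀ i, V.type i ≠ τ i → (V.arrow i).IsIso) :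
    ∃ V' : ZigzagModule F n, V'.type = τ ∧ GraphIso V V' ∧
      Relation.ReflTransGen
        (fun X Y : ZigzagModule F n => ∃ k, ∃ h : (X.arrow k).IsIso, Y = X.reverseArrow k h)
        V V' := by
  classical
  induction hc : (Finset.univ.filter fun i => V.type i ≠ τ i).card generalizing V with
  | zero =>
    refine ⟨V, funext fun i => ?_, GraphIso.refl V, Relation.ReflTransGen.refl⟩
    by_contra hi
    rw [Finset.card_eq_zero] at hc
    have : i ∈ (∅ : Finset (Fin n)) := hc ▸ (by simpa using hi)
    simp at this
  | succ m ih =>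
    obtain ⟨k, hk⟩ := Finset.card_pos.1 (by omega :
      0 < (Finset.univ.filter fun i => V.type i ≠ τ i).card)
    have hk' : V.type k ≠ τ k := by simpa using hk
    have hkk : (V.reverseArrow k (h k hk')).type k = τ k :=
      Dir.eq_of_ne_of_ne (V.type_reverseArrow_self k _) hk'.symm
    have hiso : ∀ i, (V.reverseArrow k (h k hk')).type i ≠ τ i →
        ((V.reverseArrow k (h k hk')).arrow i).IsIso := by
      intro i hi
      have hik : i ≠ k := fun e => hi (e ▸ hkk)
      rw [type_reverseArrow_ne _ _ _ hik] at hi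
      have := h i hi
      simp only [reverseArrow, Function.update_of_ne hik]
      exact this
    have hcard : (Finset.univ.filter fun i => (V.reverseArrow k (h k hk')).type i ≠ τ i) =
        (Finset.univ.filter fun i => V.type i ≠ τ i).erase k := by
      ext i
      by_cases hik : i = k
      · subst hik
        simp [hkk]
      · simp [hik, type_reverseArrow_ne _ _ _ hik]
    obtain ⟨V', h1, h2, h3⟩ := ih (V.reverseArrow k (h k hk')) hiso (by
      rw [hcard, Finset.card_erase_of_mem hk, hc]
      omega)
    exact ⟨V', h1, (V.graphIso_reverseArrow k _).trans h2,
      Relation.ReflTransGen.head ⟨k, h k hk', rfl⟩ h3⟩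

theorem Equivalent.graphIso {V W : ZigzagModule F n} (h : Equivalent V W) : GraphIso V W := by
  obtain ⟨V', h1, h2⟩ := h
  refine GraphIso.trans ?_ (isomorphic_iff.1 h2).2
  clear h2
  induction h1 with
  | refl => exact GraphIso.refl V
  | tail _ hs ih =>
    obtain ⟨k, hk, rfl⟩ := hs
    exact ih.trans (graphIso_reverseArrow _ k hk)

/-- The relation `≾` is the relation of being a direct summand up to arrow reversal. -/
theorem precsim_iff {W V : ZigzagModule F n} : Precsim W V ↔ ∃ U, IsGraphSum V W U := by
  constructor
  · rintro ⟨W', h1, U, hU, h2⟩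
    exact ⟨U, ((isGraphSum_directSum hU.symm).congr_left
      (isomorphic_iff.1 h2).2.symm).congr_mid h1.graphIso.symm⟩
  · rintro ⟨U, h⟩
    obtain ⟨W', hW1, hW2, hW3⟩ := W.exists_retype V.type fun i hi => h.isIso_left hi
    obtain ⟨U', hU1, hU2, -⟩ := U.exists_retype V.type fun i hi => h.swap.isIso_left hi
    have ht : W'.type = U'.type := hW1.trans hU1.symm
    refine ⟨W', ⟨W', hW3, isomorphic_iff.2 ⟨rfl, GraphIso.refl _⟩⟩, U', ht.symm,
      isomorphic_iff.2 ⟨?_, ?_⟩⟩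
    · rw [type_directSum ht, hW1]
    · exact ((h.congr_mid hW2).congr_right hU2).graphIso (isGraphSum_directSum ht)

theorem Precsim.trans {V W U : ZigzagModule F n} (h : Precsim V W) (h' : Precsim W U) :
    Precsim V U := by
  obtain ⟨X, e, he⟩ := precsim_iff.1 h
  obtain ⟨Y, e', he'⟩ := precsim_iff.1 h'
  -- `X` is itself a summand of `U` up to reversal, so both `X` and `Y` can be given the type of `U`
  have hX : ∀ i, X.type i ≠ U.type i → (X.arrow i).IsIso := by
    intro i hi
    by_cases hiW : X.type i = W.type i
    · exact IsGraphSum.isIso_of_isIso (IsGraphSum.swap ⟨e, he⟩)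
        ((he' i).isIso_left fun h => hi (hiW.trans h))
    · exact (he i).swap.isIso_left hiW
  obtain ⟨X', hX1, hX2, -⟩ := X.exists_retype U.type hX
  obtain ⟨Y', hY1, hY2, -⟩ := Y.exists_retype U.type fun i hi => (he' i).swap.isIso_left hi
  obtain ⟨f, hf⟩ := IsGraphSum.congr_right hX2 ⟨e, he⟩
  obtain ⟨f', hf'⟩ := IsGraphSum.congr_right hY2 ⟨e', he'⟩
  have hXY := hX1.trans hY1.symm
  refine precsim_iff.2 ⟨directSum X' Y', fun i => (f' i).trans (((f i).prodCongr
    (LinearEquiv.refl F _)).trans (LinearEquiv.prodAssoc F _ _ _)), fun i x y => ?_⟩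
  rw [hf' i x y, hf i _ _, and_assoc]
  exact and_congr Iff.rfl (ZArrow.mem_graph_directSum (congrFun hXY i)
    ((f i.castSucc (f' i.castSucc x).1).2, (f' i.castSucc x).2)
    ((f i.succ (f' i.succ y).1).2, (f' i.succ y).2)).symm

/-- A module all of whose spaces vanish precedes every module. -/
theorem precsim_of_subsingleton {V : ZigzagModule F n} (h : ∀ i, Subsingleton (V.space i))
    (W : ZigzagModule F n) : Precsim V W :=
  precsim_iff.2 ⟨W, ((graphIso_iff_isGraphSum h).1 (GraphIso.refl W)).swap⟩

end ZigzagModule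

/-! ### Splitting off an interval module -/

/-- An arrow restricts to the kernels of a morphism to an arrow of the same direction. -/
theorem ZArrow.exists_restrict {F : Type u} [Field F] {A B : Type u} [AddCommGroup A] [Module F A]
    [AddCommGroup B] [Module F B] {A' B' : Type u} [AddCommGroup A'] [Module F A']
    [AddCommGroup B'] [Module F B'] (a : ZArrow F A B) (a' : ZArrow F A' B') (hd : a.dir = a'.dir)
    (φ : A →ₗ[F] A') (ψ : B →ₗ[F] B')
    (h : ∀ x y, (x, y) ∈ a.graph → (φ x, ψ y) ∈ a'.graph) :
    ∃ r : ZArrow F (LinearMap.ker φ) (LinearMap.ker ψ), r.dir = a.dir ∧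
      ∀ x y, (x, y) ∈ r.graph ↔ ((x : A), (y : B)) ∈ a.graph := by
  cases a with
  | fwd f =>
    cases a' with
    | bwd g => simp [dir] at hd
    | fwd g =>
      refine ⟨fwd (f.restrict fun x hx => ?_), rfl, fun x y => ?_⟩
      · have := h x (f x) (by simp)
        rw [LinearMap.mem_ker] at hx ⊢
        simpa [hx, eq_comm] using this
      · simp [Subtype.ext_iff]
  | bwd f =>
    cases a' with
    | fwd g => simp [dir] at hd
    | bwd g =>
      refine ⟨bwd (f.restrict fun x hx => ?_), rfl, fun x y => ?_⟩
      · have := h (f x) x (by simp)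
        rw [LinearMap.mem_ker] at hx ⊢
        simpa [hx, eq_comm] using this
      · simp [Subtype.ext_iff]

namespace ZigzagModule

variable {F : Type u} [Field F] {n : ℕ}

/-- A retract is a direct summand; the complement is the kernel of the retraction. -/
theorem exists_isGraphSum_of_retract {V W : ZigzagModule F n} (ht : V.type = W.type)
    (φ : ∀ i, W.space i →ₗ[F] V.space i) (ψ : ∀ i, V.space i →ₗ[F] W.space i)
    (hφ : ∀ (i : Fin n) (x : W.space i.castSucc) (y : W.space i.succ),
      (x, y) ∈ (W.arrow i).graph → (φ _ x, φ _ y) ∈ (V.arrow i).graph)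
    (hψ : ∀ (i : Fin n) (x : V.space i.castSucc) (y : V.space i.succ),
      (x, y) ∈ (V.arrow i).graph → (ψ _ x, ψ _ y) ∈ (W.arrow i).graph)
    (h : ∀ i x, ψ i (φ i x) = x) : ∃ U : ZigzagModule F n, U.type = V.type ∧ IsGraphSum V W U := by
  choose r hr hr' using fun i : Fin n =>
    (V.arrow i).exists_restrict (W.arrow i) (congrFun ht i) (ψ _) (ψ _) (hψ i)
  let U : ZigzagModule F n :=
    { space := fun i => FGModuleCat.of F (LinearMap.ker (ψ i))
      arrow := fun i => r i }
  have hk : ∀ i (v : V.space i), v - φ i (ψ i v) ∈ LinearMap.ker (ψ i) := fun i v => by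
    rw [LinearMap.mem_ker, map_sub, h, sub_self]
  let T : ∀ i, V.space i →ₗ[F] LinearMap.ker (ψ i) := fun i =>
    LinearMap.codRestrict _ (LinearMap.id - φ i ∘ₗ ψ i) (hk i)
  have hT : ∀ i v, ((T i v : LinearMap.ker (ψ i)) : V.space i) = v - φ i (ψ i v) :=
    fun i v => rfl
  refine ⟨U, funext hr, fun i => LinearEquiv.ofBijective ((ψ i).prod (T i)) ⟨?_, ?_⟩,
    fun i x y => ?_⟩
  · rw [injective_iff_map_eq_zero]
    intro v hv
    have h1 : ψ i v = 0 := congrArg Prod.fst hv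
    have h2 : T i v = 0 := congrArg Prod.snd hv
    have h3 := hT i v
    rw [h2, h1] at h3
    simpa using h3.symm
  · rintro ⟨w, k⟩
    have hk : ψ i (k : V.space i) = 0 := k.2
    refine ⟨φ i w + (k : V.space i), Prod.ext ?_ (Subtype.ext ?_)⟩
    · change ψ i (φ i w + (k : V.space i)) = w
      rw [map_add, h, hk, add_zero]
    · change φ i w + (k : V.space i) - φ i (ψ i (φ i w + (k : V.space i))) = k
      rw [map_add, h, hk, add_zero, add_sub_cancel_left]
  · change _ ↔ (ψ _ x, ψ _ y) ∈ _ ∧ (T _ x, T _ y) ∈ (r i).graph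
    rw [hr', hT, hT]
    constructor
    · intro hxy
      exact ⟨hψ i x y hxy, (V.arrow i).graph.sub_mem hxy (hφ i _ _ (hψ i x y hxy))⟩
    · rintro ⟨h1, h2⟩
      simpa using (V.arrow i).graph.add_mem h2 (hφ i _ _ h1)

/-- Membership of an index in an interval. -/
def MemBar (I : Bar n) (i : Fin (n + 1)) : Prop := I.1.1 ≤ i ∧ i ≤ I.1.2

theorem coe_eq_zero_of_not_memBar {I : Bar n} {i : Fin (n + 1)} (h : ¬ MemBar I i)
    (c : intervalSpace F I i) : (c : F) = 0 := by
  have hb : intervalSpace F I i = ⊥ := if_neg h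
  exact (Submodule.mem_bot F).1 (hb ▸ c.2)

theorem mem_intervalSpace {I : Bar n} {i : Fin (n + 1)} (h : MemBar I i) (c : F) :
    c ∈ intervalSpace F I i := by
  have hb : intervalSpace F I i = ⊤ := if_pos h
  exact hb ▸ Submodule.mem_top

theorem coe_inclusionOrZero {I : Bar n} {i j : Fin (n + 1)}
    (c : intervalSpace F I i) (c' : intervalSpace F I j) :
    inclusionOrZero (intervalSpace F I i) (intervalSpace F I j) c = c' ↔
      (MemBar I j → (c : F) = c') := by
  rw [Subtype.ext_iff]
  by_cases hj : MemBar I j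
  · have hle : intervalSpace F I i ≤ intervalSpace F I j := fun x _ => mem_intervalSpace hj x
    rw [inclusionOrZero, dif_pos hle]
    simp [hj]
  · rw [coe_eq_zero_of_not_memBar hj, coe_eq_zero_of_not_memBar hj]
    simp [hj]

/-- Related pairs of scalars for the structure maps of an interval module: they agree if the
target of the structure map is one of the nonzero spaces, and there is no condition otherwise. -/
theorem mem_graph_intervalModule (τ : Fin n → Dir) (I : Bar n) (i : Fin n)
    (c : intervalSpace F I i.castSucc) (c' : intervalSpace F I i.succ) :
    (c, c') ∈ ZArrow.graph (A := intervalSpace F I i.castSucc) (B := intervalSpace F I i.succ)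
        ((intervalModule F τ I).arrow i) ↔
      ((τ i = Dir.right → MemBar I i.succ → (c : F) = c') ∧
        (τ i = Dir.left → MemBar I i.castSucc → (c : F) = c')) := by
  change (c, c') ∈ (intervalArrow _ _ (τ i)).graph ↔ _
  cases h : τ i
  · simp only [intervalArrow, ZArrow.mem_graph_fwd, coe_inclusionOrZero]
    simp
  · simp only [intervalArrow, ZArrow.mem_graph_bwd, coe_inclusionOrZero]
    simp [eq_comm]

theorem type_intervalModule (τ : Fin n → Dir) (I : Bar n) : (intervalModule F τ I).type = τ := by
  funext i
  change (intervalArrow _ _ (τ i)).dir = τ i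
  cases τ i <;> rfl

/-- An interval module is a direct summand as soon as there are vectors `xᵢ` and functionals `fᵢ`
supported on the interval, compatible with the structure maps with target inside (respectively
source inside) the interval, and with `fᵢ xᵢ = 1` on the interval. -/
theorem exists_isGraphSum_intervalModule {V : ZigzagModule F n} (I : Bar n)
    (x : ∀ i, V.space i) (f : ∀ i, V.space i →ₗ[F] F)
    (hf : ∀ i, ¬ MemBar I i → f i = 0) (hfx : ∀ i, MemBar I i → f i (x i) = 1)
    (hxc : ∀ (i : Fin n) (c c' : F), (¬ MemBar I i.castSucc → c = 0) → (¬ MemBar I i.succ → c' = 0) →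
      (V.type i = Dir.right → MemBar I i.succ → c = c') →
      (V.type i = Dir.left → MemBar I i.castSucc → c = c') →
      (c • x i.castSucc, c' • x i.succ) ∈ (V.arrow i).graph)
    (hfc : ∀ (i : Fin n) (v : V.space i.castSucc) (w : V.space i.succ),
      (v, w) ∈ (V.arrow i).graph →
      (V.type i = Dir.right → MemBar I i.succ → f _ v = f _ w) ∧
      (V.type i = Dir.left → MemBar I i.castSucc → f _ v = f _ w)) :
    ∃ U : ZigzagModule F n, U.type = V.type ∧ IsGraphSum V (intervalModule F V.type I) U := by
  have hmem : ∀ i v, f i v ∈ intervalSpace F I i := fun i v => by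
    by_cases h : MemBar I i
    · exact mem_intervalSpace h _
    · rw [hf i h]
      exact Submodule.zero_mem _
  refine exists_isGraphSum_of_retract (type_intervalModule _ _).symm
    (fun i => (LinearMap.toSpanSingleton F (V.space i) (x i)) ∘ₗ (intervalSpace F I i).subtype)
    (fun i => (f i).codRestrict (intervalSpace F I i) (hmem i)) ?_ ?_ ?_
  · intro i (c : intervalSpace F I i.castSucc) (c' : intervalSpace F I i.succ) h
    have h' := (mem_graph_intervalModule _ _ _ _ _).1 h
    exact hxc i _ _ (fun hi => coe_eq_zero_of_not_memBar hi c)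
      (fun hi => coe_eq_zero_of_not_memBar hi c') h'.1 h'.2
  · intro i v w h
    exact (mem_graph_intervalModule _ _ _ _ _).2 (hfc i v w h)
  · intro i (c : intervalSpace F I i)
    refine Subtype.ext ?_
    change f i ((c : F) • x i) = c
    by_cases h : MemBar I i
    · rw [map_smul, hfx i h, smul_eq_mul, mul_one]
    · rw [coe_eq_zero_of_not_memBar h c, zero_smul, map_zero]

end ZigzagModule

/-! ### Existence of interval decompositions -/

theorem LinearMap.exists_comp_eq_and_forall_mem_eq_zero {F : Type*} [Field F] {A B : Type*}
    [AddCommGroup A] [Module F A] [AddCommGroup B] [Module F B] (p : A →ₗ[F] B) (g : A →ₗ[F] F)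
    (T : Submodule F B) (h : ∀ x, p x ∈ T → g x = 0) :
    ∃ k : B →ₗ[F] F, (∀ x, k (p x) = g x) ∧ ∀ y ∈ T, k y = 0 := by
  have hg : g ∈ LinearMap.range (T.mkQ ∘ₗ p).dualMap := by
    rw [LinearMap.range_dualMap_eq_dualAnnihilator_ker, Submodule.mem_dualAnnihilator]
    intro x hx
    exact h x (by simpa using hx)
  obtain ⟨k, hk⟩ := hg
  refine ⟨k ∘ₗ T.mkQ, fun x => LinearMap.congr_fun hk x, fun y hy => ?_⟩
  have : T.mkQ y = 0 := by simpa using hy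
  rw [LinearMap.comp_apply, this, map_zero]

namespace ZigzagModule

variable {F : Type u} [Field F] {n : ℕ}

/-- The families of vectors that are compatible with all structure maps between the indices `b`
and `d`. -/
def compatFamilies (V : ZigzagModule F n) (b d : Fin (n + 1)) :
    Submodule F (∀ i, V.space i) where
  carrier := {x | ∀ i : Fin n, b ≤ i.castSucc → i.succ ≤ d →
    (x i.castSucc, x i.succ) ∈ (V.arrow i).graph}
  add_mem' hx hy i hb hd := (V.arrow i).graph.add_mem (hx i hb hd) (hy i hb hd)
  zero_mem' i _ _ := ZArrow.zero_mem_graph (V.arrow i)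
  smul_mem' c _ hx i hb hd := (V.arrow i).graph.smul_mem c (hx i hb hd)

/-- The vectors in `V_b` from which a compatible family on `[b, d]` can start that ends in `T`. -/
def startSpace (V : ZigzagModule F n) (b d : Fin (n + 1)) (T : Submodule F (V.space d)) :
    Submodule F (V.space b) :=
  (V.compatFamilies b d ⊓ T.comap (LinearMap.proj d)).map (LinearMap.proj b)

theorem mem_startSpace {V : ZigzagModule F n} {b d : Fin (n + 1)} {T : Submodule F (V.space d)}
    {v : V.space b} :
    v ∈ V.startSpace b d T ↔ ∃ x ∈ V.compatFamilies b d, x d ∈ T ∧ x b = v := by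
  simp [startSpace, and_assoc]

/-- The vectors that are related to a vector in `T` by the structure map at `i`. -/
def pullArrow (V : ZigzagModule F n) (i : Fin n) (T : Submodule F (V.space i.succ)) :
    Submodule F (V.space i.castSucc) :=
  ((V.arrow i).graph ⊓ T.comap (LinearMap.snd F _ _)).map (LinearMap.fst F _ _)

theorem mem_pullArrow {V : ZigzagModule F n} {i : Fin n} {T : Submodule F (V.space i.succ)}
    {v : V.space i.castSucc} : v ∈ V.pullArrow i T ↔ ∃ w ∈ T, (v, w) ∈ (V.arrow i).graph := by
  simp [pullArrow, and_comm]

theorem startSpace_self {V : ZigzagModule F n} {b : Fin (n + 1)} (T : Submodule F (V.space b)) :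
    V.startSpace b b T = T := by
  ext v
  rw [mem_startSpace]
  constructor
  · rintro ⟨x, -, h, rfl⟩
    exact h
  · intro h
    refine ⟨Function.update 0 b v, fun i h1 h2 => ?_, by simpa using h, by simp⟩
    exact absurd (h1.trans_lt (Fin.castSucc_lt_succ)) (not_lt.2 h2)

theorem startSpace_succ {V : ZigzagModule F n} {b : Fin (n + 1)} {i : Fin n} (hb : b ≤ i.castSucc)
    (T : Submodule F (V.space i.succ)) :
    V.startSpace b i.succ T = V.startSpace b i.castSucc (V.pullArrow i T) := by
  ext v
  rw [mem_startSpace, mem_startSpace]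
  constructor
  · rintro ⟨x, hx, hT, rfl⟩
    exact ⟨x, fun j h1 h2 => hx j h1 (h2.trans (Fin.castSucc_lt_succ).le),
      mem_pullArrow.2 ⟨_, hT, hx i hb le_rfl⟩, rfl⟩
  · rintro ⟨x, hx, hT, rfl⟩
    obtain ⟨w, hw, hxw⟩ := mem_pullArrow.1 hT
    refine ⟨Function.update x i.succ w, fun j h1 h2 => ?_, by simpa using hw, ?_⟩
    · have hj : j.castSucc ≠ i.succ := by
        intro h
        rw [← h] at h2
        exact absurd Fin.castSucc_lt_succ (not_lt.2 h2)
      rw [Function.update_of_ne hj]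
      by_cases hji : j = i
      · subst hji
        rwa [Function.update_self]
      · rw [Function.update_of_ne (by simpa using hji)]
        refine hx j h1 ?_
        have : j < i := lt_of_le_of_ne (by simpa using h2) hji
        exact Fin.succ_le_castSucc_iff.2 this
    · rw [Function.update_of_ne]
      exact (hb.trans_lt Fin.castSucc_lt_succ).ne

theorem le_castSucc_or_eq {b : Fin (n + 1)} {i : Fin n} (h : b ≤ i.succ) :
    b ≤ i.castSucc ∨ b = i.succ := by
  rcases h.lt_or_eq with h | h
  · exact Or.inl (by simpa [Fin.le_def, Fin.lt_def, Nat.lt_succ_iff] using h)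
  · exact Or.inr h

/-- A functional on `V_b` extends to a compatible family of functionals on `[b, d]`, with a
prescribed space `T` in the kernel of the last one, as soon as it vanishes on the starting vectors
of the compatible families ending in `T`. -/
theorem exists_compat_functionals (V : ZigzagModule F n) (b d : Fin (n + 1)) (hbd : b ≤ d)
    (T : Submodule F (V.space d)) (f : V.space b →ₗ[F] F)
    (hf : ∀ v ∈ V.startSpace b d T, f v = 0) :
    ∃ g : ∀ i, V.space i →ₗ[F] F, g b = f ∧ (∀ v ∈ T, g d v = 0) ∧
      ∀ i : Fin n, b ≤ i.castSucc → i.succ ≤ d → ∀ v w, (v, w) ∈ (V.arrow i).graph →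
        g _ v = g _ w := by
  have base : ∀ (T : Submodule F (V.space b)), (∀ v ∈ V.startSpace b b T, f v = 0) →
      ∃ g : ∀ i, V.space i →ₗ[F] F, g b = f ∧ (∀ v ∈ T, g b v = 0) ∧
        ∀ i : Fin n, b ≤ i.castSucc → i.succ ≤ b → ∀ v w, (v, w) ∈ (V.arrow i).graph →
          g _ v = g _ w := by
    intro T hT
    rw [startSpace_self] at hT
    refine ⟨Function.update (fun _ => 0) b f, by simp, by simpa using hT, fun i h1 h2 => ?_⟩
    exact absurd (h1.trans_lt (Fin.castSucc_lt_succ)) (not_lt.2 h2)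
  induction d using Fin.induction with
  | zero =>
    obtain rfl : b = 0 := Fin.le_zero_iff.1 hbd
    exact base T hf
  | succ i ih =>
    rcases le_castSucc_or_eq hbd with hb | rfl
    · rw [startSpace_succ hb] at hf
      obtain ⟨g, hgb, hgT, hg⟩ := ih hb _ hf
      obtain ⟨k, hk, hkT⟩ : ∃ k : V.space i.succ →ₗ[F] F,
          (∀ v w, (v, w) ∈ (V.arrow i).graph → g _ v = k w) ∧ ∀ w ∈ T, k w = 0 := by
        have hpull : ∀ v w, w ∈ T → (v, w) ∈ (V.arrow i).graph → g _ v = 0 :=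
          fun v w hw h => hgT v (mem_pullArrow.2 ⟨w, hw, h⟩)
        cases ha : V.arrow i with
        | fwd p =>
          rw [ha] at hpull
          obtain ⟨k, hk, hkT⟩ := p.exists_comp_eq_and_forall_mem_eq_zero (g i.castSucc) T
            fun x hx => hpull x _ hx (by simp)
          refine ⟨k, fun v w h => ?_, hkT⟩
          rw [ZArrow.mem_graph_fwd] at h
          rw [← hk, h]
        | bwd p =>
          rw [ha] at hpull
          refine ⟨g i.castSucc ∘ₗ p, fun v w h => ?_, fun w hw => hpull _ w hw (by simp)⟩
          rw [ZArrow.mem_graph_bwd] at h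
          rw [LinearMap.comp_apply, h]
      refine ⟨Function.update g i.succ k, ?_, by simpa using hkT, fun j h1 h2 v w hvw => ?_⟩
      · rw [Function.update_of_ne, hgb]
        exact (hb.trans_lt Fin.castSucc_lt_succ).ne
      · have hj : j.castSucc ≠ i.succ := by
          intro h
          rw [← h] at h2
          exact absurd Fin.castSucc_lt_succ (not_lt.2 h2)
        rw [Function.update_of_ne hj]
        by_cases hji : j = i
        · subst hji
          rw [Function.update_self]
          exact hk v w hvw
        · rw [Function.update_of_ne (by simpa using hji)]
          refine hg j h1 ?_ v w hvw
          have : j < i := lt_of_le_of_ne (by simpa using h2) hji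
          exact Fin.succ_le_castSucc_iff.2 this
    · exact base T hf

theorem eq_of_compat {α : Type*} {y : Fin (n + 1) → α} {b d : Fin (n + 1)}
    (h : ∀ i : Fin n, b ≤ i.castSucc → i.succ ≤ d → y i.castSucc = y i.succ) :
    ∀ i, b ≤ i → i ≤ d → y i = y b := by
  intro i
  induction i using Fin.induction with
  | zero =>
    intro hb _
    rw [Fin.le_zero_iff.1 hb]
  | succ i ih =>
    intro hb hd
    rcases le_castSucc_or_eq hb with hb | rfl
    · rw [← h i hb hd]
      exact ih hb (Fin.castSucc_lt_succ.le.trans hd)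
    · rfl

/-- If a compatible family on `[b, d]` starts at a vector that is not the starting vector of a
compatible family ending in `T`, then `[b, d]` carries a direct summand, provided that the spaces
before `b` vanish, that the family can be continued by zero, and that functionals vanishing on `T`
can be continued by zero. -/
theorem exists_isGraphSum_of_notMem_startSpace {V : ZigzagModule F n} {b d : Fin (n + 1)}
    (hbd : b ≤ d) (hV : ∀ i < b, Subsingleton (V.space i)) (T : Submodule F (V.space d))
    {x : ∀ i, V.space i} (hx : x ∈ V.compatFamilies b d) (hxT : x b ∉ V.startSpace b d T)
    (hend : ∀ i : Fin n, i.castSucc = d →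
      (V.type i = Dir.right → (x i.castSucc, 0) ∈ (V.arrow i).graph) ∧
      (V.type i = Dir.left → ∀ g : ∀ j, V.space j →ₗ[F] F, (∀ v ∈ T, g d v = 0) →
        ∀ v w, (v, w) ∈ (V.arrow i).graph → g i.castSucc v = 0)) :
    ∃ U : ZigzagModule F n, U.type = V.type ∧
      IsGraphSum V (intervalModule F V.type ⟨(b, d), hbd⟩) U := by
  classical
  obtain ⟨f₀, hf₀x, hf₀⟩ := Submodule.exists_le_ker_of_notMem hxT
  have hf₁ : ∀ v ∈ V.startSpace b d T, ((f₀ (x b))⁻¹ • f₀) v = 0 := fun v hv => by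
    rw [LinearMap.smul_apply, LinearMap.mem_ker.1 (hf₀ hv), smul_zero]
  obtain ⟨g, hgb, hgT, hg⟩ := V.exists_compat_functionals b d hbd T _ hf₁
  have hgx : ∀ i, b ≤ i → i ≤ d → g i (x i) = 1 := by
    intro i h1 h2
    rw [eq_of_compat (y := fun i => g i (x i)) (b := b) (d := d)
      (fun i h1 h2 => hg i h1 h2 _ _ (hx i h1 h2)) i h1 h2]
    simp [hgb, hf₀x]
  let I : Bar n := ⟨(b, d), hbd⟩
  have hI : ∀ i, MemBar I i ↔ b ≤ i ∧ i ≤ d := fun i => Iff.rfl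
  -- the two ways in which an arrow can cross the boundary of the interval
  have hright : ∀ i : Fin n, MemBar I i.castSucc → ¬ MemBar I i.succ → i.castSucc = d := by
    intro i h1 h2
    rw [hI] at h1 h2
    simp only [Fin.le_def, Fin.ext_iff, Fin.val_castSucc, Fin.val_succ] at *
    omega
  have hleft : ∀ i : Fin n, ¬ MemBar I i.castSucc → MemBar I i.succ → i.castSucc < b := by
    intro i h1 h2
    rw [hI] at h1 h2
    simp only [Fin.le_def, Fin.lt_def, Fin.val_castSucc, Fin.val_succ] at *
    omega
  refine exists_isGraphSum_intervalModule I x (fun i => if MemBar I i then g i else 0)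
    (fun i h => if_neg h) (fun i h => ?_) ?_ ?_
  · simp only [if_pos h]
    exact hgx i h.1 h.2
  · intro i c c' hc hc' hR hL
    by_cases h1 : MemBar I i.castSucc <;> by_cases h2 : MemBar I i.succ
    · have : c = c' := by
        cases hd : V.type i
        · exact hR hd h2
        · exact hL hd h1
      subst this
      exact (V.arrow i).graph.smul_mem c (hx i h1.1 h2.2)
    · rw [hc' h2, zero_smul]
      cases hd : V.type i
      · have := (V.arrow i).graph.smul_mem c ((hend i (hright i h1 h2)).1 hd)
        simpa using this
      · rw [hL hd h1, hc' h2, zero_smul]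
        exact ZArrow.zero_mem_graph _
    · have := hV _ (hleft i h1 h2)
      cases hd : V.type i
      · rw [← hR hd h2, hc h1, zero_smul, zero_smul]
        exact ZArrow.zero_mem_graph _
      · cases ha : V.arrow i with
        | fwd p => simp [type, ha, ZArrow.dir] at hd
        | bwd p => exact (ZArrow.mem_graph_bwd _ _ _).2 (Subsingleton.elim _ _)
    · rw [hc h1, hc' h2, zero_smul, zero_smul]
      exact ZArrow.zero_mem_graph _
  · intro i v w hvw
    refine ⟨fun hd h2 => ?_, fun hd h1 => ?_⟩
    · by_cases h1 : MemBar I i.castSucc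
      · simp only [if_pos h1, if_pos h2]
        exact hg i h1.1 h2.2 v w hvw
      · have := hV _ (hleft i h1 h2)
        cases ha : V.arrow i with
        | fwd p =>
          rw [ha, ZArrow.mem_graph_fwd, Subsingleton.elim v 0, map_zero] at hvw
          rw [Subsingleton.elim v 0, ← hvw, map_zero, map_zero]
        | bwd p => simp [type, ha, ZArrow.dir] at hd
    · by_cases h2 : MemBar I i.succ
      · simp only [if_pos h1, if_pos h2]
        exact hg i h1.1 h2.2 v w hvw
      · simp only [if_pos h1, if_neg h2]
        exact (hend i (hright i h1 h2)).2 hd g hgT v w hvw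

/-- A nonzero zigzag module has an interval module as a direct summand. The left end of the interval
is the first index `b` at which the module does not vanish. If no interval starting at `b` splits
off, then each vector of `V_b` starts a compatible family reaching the last index while no nonzero
vector starts one ending in zero, which contradicts that nothing splits off at the last index. -/
theorem exists_intervalModule_summand (V : ZigzagModule F n)
    (h : ∃ i, ¬ Subsingleton (V.space i)) :
    ∃ (I : Bar n) (U : ZigzagModule F n), U.type = V.type ∧
      IsGraphSum V (intervalModule F V.type I) U := by
  obtain ⟨b, hb, hmin⟩ := WellFounded.has_min (wellFounded_lt (α := Fin (n + 1)))
    {i | ¬ Subsingleton (V.space i)} h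
  have hV : ∀ i < b, Subsingleton (V.space i) := fun i hi => by
    by_contra hc
    exact hmin i hc hi
  by_contra hno
  push Not at hno
  -- a compatible family from `b` to `d` that extends by zero starts in `startSpace b d T`, where `T`
  -- is such that functionals vanishing on `T` extend by zero
  have hno' : ∀ d, b ≤ d → ∀ T : Submodule F (V.space d), ∀ x ∈ V.compatFamilies b d,
      (∀ i : Fin n, i.castSucc = d →
        (V.type i = Dir.right → (x i.castSucc, 0) ∈ (V.arrow i).graph) ∧
        (V.type i = Dir.left → ∀ g : ∀ j, V.space j →ₗ[F] F, (∀ v ∈ T, g d v = 0) →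
          ∀ v w, (v, w) ∈ (V.arrow i).graph → g i.castSucc v = 0)) →
      x b ∈ V.startSpace b d T := by
    intro d hbd T x hx hend
    by_contra hxT
    obtain ⟨U, hU, hs⟩ := exists_isGraphSum_of_notMem_startSpace hbd hV T hx hxT hend
    exact hno _ U hU hs
  -- `T = ⊥` is used for arrows to the right and at the last index, and `T` is the range of the
  -- structure map for arrows to the left
  have key : ∀ d, b ≤ d → V.startSpace b d ⊥ = ⊥ ∧ V.startSpace b d ⊤ = ⊤ := by
    intro d
    induction d using Fin.induction with
    | zero =>
      intro hbd
      obtain rfl : b = 0 := Fin.le_zero_iff.1 hbd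
      exact ⟨startSpace_self _, startSpace_self _⟩
    | succ i ih =>
      intro hbd
      rcases le_castSucc_or_eq hbd with hbi | rfl
      · obtain ⟨ih1, ih2⟩ := ih hbi
        rw [startSpace_succ hbi, startSpace_succ hbi]
        cases hd : V.type i
        · have htop : V.pullArrow i ⊤ = ⊤ := by
            rw [eq_top_iff]
            intro v _
            rw [mem_pullArrow]
            cases ha : V.arrow i with
            | fwd p => exact ⟨p v, trivial, by simp⟩
            | bwd p => simp [type, ha, ZArrow.dir] at hd
          refine ⟨?_, by rw [htop, ih2]⟩
          rw [eq_bot_iff, ← ih1]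
          intro v hv
          obtain ⟨x, hx, hx0, rfl⟩ := mem_startSpace.1 hv
          refine hno' _ hbi ⊥ x hx fun j hj => ?_
          obtain rfl : j = i := Fin.castSucc_injective _ hj
          refine ⟨fun _ => ?_, fun hd' => absurd (hd.symm.trans hd') (by simp)⟩
          obtain ⟨w, hw, hxw⟩ := mem_pullArrow.1 hx0
          rwa [(Submodule.mem_bot F).1 hw] at hxw
        · have hbot : V.pullArrow i ⊥ = ⊥ := by
            rw [eq_bot_iff]
            intro v hv
            obtain ⟨w, hw, hvw⟩ := mem_pullArrow.1 hv
            rw [(Submodule.mem_bot F).1 hw] at hvw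
            cases ha : V.arrow i with
            | bwd p => simpa [ha, eq_comm] using hvw
            | fwd p => simp [type, ha, ZArrow.dir] at hd
          refine ⟨by rw [hbot, ih1], ?_⟩
          rw [eq_top_iff, ← ih2]
          intro v hv
          obtain ⟨x, hx, -, rfl⟩ := mem_startSpace.1 hv
          refine hno' _ hbi _ x hx fun j hj => ?_
          obtain rfl : j = i := Fin.castSucc_injective _ hj
          refine ⟨fun hd' => absurd (hd.symm.trans hd') (by simp), fun _ g hg v w hvw => ?_⟩
          exact hg v (mem_pullArrow.2 ⟨w, trivial, hvw⟩)
      · exact ⟨startSpace_self _, startSpace_self _⟩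
  obtain ⟨k1, k2⟩ := key (Fin.last n) (Fin.le_last b)
  apply hb
  refine subsingleton_of_forall_eq 0 fun v => ?_
  have hv : v ∈ V.startSpace b (Fin.last n) ⊤ := k2 ▸ Submodule.mem_top
  obtain ⟨x, hx, -, rfl⟩ := mem_startSpace.1 hv
  have := hno' _ (Fin.le_last b) ⊥ x hx fun j hj => absurd hj (Fin.castSucc_lt_last j).ne
  rw [k1] at this
  exact (Submodule.mem_bot F).1 this

theorem IsGraphSum.finrank_eq {V W U : ZigzagModule F n} (h : IsGraphSum V W U)
    (i : Fin (n + 1)) :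
    Module.finrank F (V.space i) =
      Module.finrank F (W.space i) + Module.finrank F (U.space i) := by
  obtain ⟨e, -⟩ := h
  rw [(e i).finrank_eq, Module.finrank_prod]

theorem finrank_intervalModule_pos (τ : Fin n → Dir) (I : Bar n) :
    0 < Module.finrank F ((intervalModule F τ I).space I.1.1) := by
  have : Nontrivial ((intervalModule F τ I).space I.1.1) := by
    refine ⟨⟨(⟨1, mem_intervalSpace ⟨le_rfl, I.2⟩ 1⟩ : intervalSpace F I I.1.1), 0, fun h => ?_⟩⟩
    exact one_ne_zero (congrArg Subtype.val h)
  exact Module.finrank_pos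

theorem type_intervalSum (τ : Fin n → Dir) (D : List (Bar n)) : (intervalSum F τ D).type = τ := by
  induction D with
  | nil =>
    funext i
    change (ZArrow.zero (τ i)).dir = τ i
    cases τ i <;> rfl
  | cons I D ih =>
    exact (type_directSum ((type_intervalModule τ I).trans ih.symm)).trans
      (type_intervalModule τ I)

theorem isGraphSum_intervalSum_cons (τ : Fin n → Dir) (I : Bar n) (D : List (Bar n)) :
    IsGraphSum (intervalSum F τ (I :: D)) (intervalModule F τ I) (intervalSum F τ D) :=
  isGraphSum_directSum ((type_intervalModule τ I).trans (type_intervalSum τ D).symm)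

theorem graphIso_of_subsingleton {V W : ZigzagModule F n} (hV : ∀ i, Subsingleton (V.space i))
    (hW : ∀ i, Subsingleton (W.space i)) : GraphIso V W :=
  ⟨fun _ => 0, fun i x y => by
    rw [Subsingleton.elim x 0, Subsingleton.elim y 0]
    simp [ZArrow.zero_mem_graph]⟩

theorem exists_graphIso_intervalSum (V : ZigzagModule F n) :
    ∃ D : List (Bar n), GraphIso V (intervalSum F V.type D) := by
  induction hN : ∑ i, Module.finrank F (V.space i) using Nat.strong_induction_on
    generalizing V with
  | _ N ih =>
    by_cases h0 : ∃ i, ¬ Subsingleton (V.space i)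
    · obtain ⟨I, U, hU, hs⟩ := V.exists_intervalModule_summand h0
      obtain ⟨D, hD⟩ := ih (∑ i, Module.finrank F (U.space i)) (by
        rw [← hN, Finset.sum_congr rfl fun i _ => hs.finrank_eq i, Finset.sum_add_distrib]
        have := Finset.sum_pos' (s := Finset.univ)
          (f := fun i => Module.finrank F ((intervalModule F V.type I).space i))
          (fun _ _ => Nat.zero_le _)
          ⟨I.1.1, Finset.mem_univ _, finrank_intervalModule_pos V.type I⟩
        omega) U rfl
      rw [hU] at hD
      exact ⟨I :: D, (hs.congr_right hD).graphIso (isGraphSum_intervalSum_cons _ I D)⟩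
    · push Not at h0
      exact ⟨[], graphIso_of_subsingleton h0 fun i => inferInstanceAs (Subsingleton PUnit)⟩

/-- Every zigzag module is a finite direct sum of interval modules. -/
theorem exists_isomorphic_intervalSum (V : ZigzagModule F n) :
    ∃ D : List (Bar n), Isomorphic V (intervalSum F V.type D) := by
  obtain ⟨D, hD⟩ := V.exists_graphIso_intervalSum
  exact ⟨D, isomorphic_iff.2 ⟨(type_intervalSum _ _).symm, hD⟩⟩

end ZigzagModule

/-! ### Uniqueness of interval decompositions -/

theorem Submodule.finrank_prod_eq {F M N : Type*} [Field F] [AddCommGroup M] [Module F M]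
    [AddCommGroup N] [Module F N] [FiniteDimensional F M] [FiniteDimensional F N]
    (P : Submodule F M) (Q : Submodule F N) :
    Module.finrank F (P.prod Q) = Module.finrank F P + Module.finrank F Q := by
  rw [← Module.finrank_prod]
  exact LinearEquiv.finrank_eq
    { toFun := fun x => (⟨x.1.1, x.2.1⟩, ⟨x.1.2, x.2.2⟩)
      invFun := fun x => ⟨(x.1, x.2), x.1.2, x.2.2⟩
      map_add' := fun _ _ => rfl
      map_smul' := fun _ _ => rfl
      left_inv := fun _ => rfl
      right_inv := fun _ => rfl }

namespace ZigzagModule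

variable {F : Type u} [Field F] {n : ℕ}

/-- The sections of `V` over the interval `I`: the families of vectors that are compatible with the
structure maps inside `I`, extended by zero outside `I`. -/
def sections (V : ZigzagModule F n) (I : Bar n) : Submodule F (∀ i, V.space i) where
  carrier := {x | x ∈ V.compatFamilies I.1.1 I.1.2 ∧ ∀ i, ¬ MemBar I i → x i = 0}
  add_mem' hx hy := ⟨add_mem hx.1 hy.1, fun i hi => by
    rw [Pi.add_apply, hx.2 i hi, hy.2 i hi, add_zero]⟩
  zero_mem' := ⟨zero_mem _, fun _ _ => rfl⟩
  smul_mem' c _ hx := ⟨Submodule.smul_mem _ c hx.1, fun i hi => by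
    rw [Pi.smul_apply, hx.2 i hi, smul_zero]⟩

/-- The sections over `I` that vanish at the index `i`. -/
def sectionsAt (V : ZigzagModule F n) (I : Bar n) (i : Fin (n + 1)) :
    Submodule F (∀ i, V.space i) :=
  V.sections I ⊓ LinearMap.ker (LinearMap.proj i)

/-- The rank of `V` over the interval `I`: the dimension of the space of sections over `I` modulo
those that are sums of a section vanishing at the left end and one vanishing at the right end. It
counts the intervals containing `I` in a decomposition of `V`. -/
noncomputable def barRank (V : ZigzagModule F n) (I : Bar n) : ℤ :=
  Module.finrank F (V.sections I) -
    Module.finrank F (V.sectionsAt I I.1.1 ⊔ V.sectionsAt I I.1.2 : Submodule F (∀ i, V.space i))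

theorem IsGraphSum.barRank_eq {V W U : ZigzagModule F n} (h : IsGraphSum V W U) (I : Bar n) :
    V.barRank I = W.barRank I + U.barRank I := by
  obtain ⟨e, he⟩ := h
  let E : (∀ i, V.space i) ≃ₗ[F] (∀ i, W.space i) × (∀ i, U.space i) :=
    { toFun := fun x => (fun i => (e i (x i)).1, fun i => (e i (x i)).2)
      invFun := fun y i => (e i).symm (y.1 i, y.2 i)
      map_add' := fun x y => by ext <;> simp
      map_smul' := fun c x => by ext <;> simp
      left_inv := fun x => by ext; simp
      right_inv := fun y => by ext <;> simp }
  have h1 : V.sections I = ((W.sections I).prod (U.sections I)).map E.symm.toLinearMap := by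
    ext x
    rw [Submodule.map_equiv_eq_comap_symm]
    change _ ∧ _ ↔ (_ ∧ _) ∧ (_ ∧ _)
    rw [and_and_and_comm]
    refine and_congr ?_ ?_
    · constructor
      · intro hx
        exact ⟨fun i h1 h2 => ((he i _ _).1 (hx i h1 h2)).1,
          fun i h1 h2 => ((he i _ _).1 (hx i h1 h2)).2⟩
      · rintro ⟨hx, hy⟩ i h1 h2
        exact (he i _ _).2 ⟨hx i h1 h2, hy i h1 h2⟩
    · rw [← forall_and]
      refine forall_congr' fun i => ?_
      rw [← forall_and]
      refine forall_congr' fun _ => ?_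
      rw [← (e i).map_eq_zero_iff]
      exact Prod.ext_iff
  have h2 : ∀ i, V.sectionsAt I i =
      ((W.sectionsAt I i).prod (U.sectionsAt I i)).map E.symm.toLinearMap := by
    intro i
    ext x
    have h1x : x ∈ V.sections I ↔ (E x).1 ∈ W.sections I ∧ (E x).2 ∈ U.sections I := by
      rw [h1, Submodule.map_equiv_eq_comap_symm]
      rfl
    rw [Submodule.map_equiv_eq_comap_symm]
    change (x ∈ V.sections I ∧ x i = 0) ↔
      (((E x).1 ∈ W.sections I ∧ (e i (x i)).1 = 0) ∧
        ((E x).2 ∈ U.sections I ∧ (e i (x i)).2 = 0))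
    rw [and_and_and_comm, h1x, ← (e i).map_eq_zero_iff]
    exact and_congr Iff.rfl Prod.ext_iff
  simp only [barRank]
  rw [h2, h2, ← Submodule.map_sup, Submodule.prod_sup_prod, h1,
    LinearEquiv.finrank_map_eq, LinearEquiv.finrank_map_eq, Submodule.finrank_prod_eq,
    Submodule.finrank_prod_eq]
  push_cast
  ring

theorem barRank_eq_zero_of_forall_apply_eq_zero {V : ZigzagModule F n} {I : Bar n}
    (h : (∀ x ∈ V.sections I, x I.1.1 = 0) ∨ (∀ x ∈ V.sections I, x I.1.2 = 0)) :
    V.barRank I = 0 := by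
  have hs : V.sectionsAt I I.1.1 ⊔ V.sectionsAt I I.1.2 = V.sections I := by
    refine le_antisymm (sup_le inf_le_left inf_le_left) fun x hx => ?_
    rcases h with h | h
    · exact Submodule.mem_sup_left ⟨hx, h x hx⟩
    · exact Submodule.mem_sup_right ⟨hx, h x hx⟩
  rw [barRank, hs, sub_self]

theorem barRank_of_subsingleton {V : ZigzagModule F n} (h : ∀ i, Subsingleton (V.space i))
    (I : Bar n) : V.barRank I = 0 :=
  barRank_eq_zero_of_forall_apply_eq_zero (Or.inl fun _ _ => Subsingleton.elim _ _)

theorem GraphIso.barRank_eq {V W : ZigzagModule F n} (h : GraphIso V W) (I : Bar n) :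
    V.barRank I = W.barRank I := by
  have hz : ∀ i, Subsingleton ((zeroModule F V.type).space i) := fun i =>
    inferInstanceAs (Subsingleton PUnit)
  rw [((graphIso_iff_isGraphSum hz).1 h).barRank_eq, barRank_of_subsingleton hz, add_zero]

/-- Containment of intervals. -/
def BarLE (I J : Bar n) : Prop := J.1.1 ≤ I.1.1 ∧ I.1.2 ≤ J.1.2

instance (I : Bar n) : DecidablePred (BarLE I) := fun J =>
  inferInstanceAs (Decidable (J.1.1 ≤ I.1.1 ∧ I.1.2 ≤ J.1.2))

/-- The inclusion of a space of an interval module into the field. -/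
noncomputable def intervalCoord (τ : Fin n → Dir) (J : Bar n) (i : Fin (n + 1)) :
    (intervalModule F τ J).space i →ₗ[F] F :=
  (intervalSpace F J i).subtype

theorem intervalCoord_injective {τ : Fin n → Dir} {J : Bar n} {i : Fin (n + 1)} :
    Function.Injective (intervalCoord (F := F) τ J i) :=
  Subtype.val_injective

theorem intervalCoord_eq_of_mem_graph {τ : Fin n → Dir} {J : Bar n} {i : Fin n}
    {c : (intervalModule F τ J).space i.castSucc} {c' : (intervalModule F τ J).space i.succ}
    (h : (c, c') ∈ ((intervalModule F τ J).arrow i).graph) (h1 : MemBar J i.castSucc)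
    (h2 : MemBar J i.succ) : intervalCoord τ J _ c = intervalCoord τ J _ c' := by
  have h := (mem_graph_intervalModule _ _ _ _ _).1 h
  cases hd : τ i
  · exact h.1 hd h2
  · exact h.2 hd h1

theorem barRank_intervalModule (τ : Fin n → Dir) (I J : Bar n) :
    (intervalModule F τ J).barRank I = if BarLE I J then 1 else 0 := by
  split_ifs with h
  · have hJ : ∀ i, MemBar I i → MemBar J i := fun i hi => ⟨h.1.trans hi.1, hi.2.trans h.2⟩
    have hconst : ∀ x ∈ (intervalModule F τ J).sections I, ∀ i, MemBar I i →
        intervalCoord τ J i (x i) = intervalCoord τ J _ (x I.1.1) := fun x hx i hi =>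
      eq_of_compat (y := fun i => intervalCoord τ J i (x i)) (b := I.1.1) (d := I.1.2)
        (fun i h1 h2 => intervalCoord_eq_of_mem_graph (hx.1 i h1 h2)
          (hJ _ ⟨h1, Fin.castSucc_lt_succ.le.trans h2⟩)
          (hJ _ ⟨h1.trans Fin.castSucc_lt_succ.le, h2⟩)) i hi.1 hi.2
    have hext : ∀ x ∈ (intervalModule F τ J).sections I,
        intervalCoord τ J _ (x I.1.1) = 0 → x = 0 := by
      intro x hx h0
      funext i
      by_cases hi : MemBar I i
      · exact intervalCoord_injective (((hconst x hx i hi).trans h0).trans (map_zero _).symm)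
      · exact hx.2 i hi
    have hbot : ∀ i, MemBar I i → (intervalModule F τ J).sectionsAt I i = ⊥ := by
      intro i hi
      rw [eq_bot_iff]
      rintro x ⟨hx, hx0⟩
      have hx0' : x i = 0 := hx0
      refine hext x hx ?_
      rw [← hconst x hx i hi, hx0', map_zero]
    rw [barRank, hbot _ ⟨le_rfl, I.2⟩, hbot _ ⟨I.2, le_rfl⟩, sup_bot_eq, finrank_bot]
    classical
    have hmem : ∀ i, (if MemBar I i then (1 : F) else 0) ∈ intervalSpace F J i := fun i => by
      split_ifs with hi
      · exact mem_intervalSpace (hJ i hi) _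
      · exact zero_mem _
    let v : ∀ i, (intervalModule F τ J).space i := fun i =>
      (⟨if MemBar I i then 1 else 0, hmem i⟩ : intervalSpace F J i)
    have hv : v ∈ (intervalModule F τ J).sections I := by
      refine ⟨fun i h1 h2 => ?_, fun i hi => Subtype.ext (if_neg hi)⟩
      have m1 : MemBar I i.castSucc := ⟨h1, Fin.castSucc_lt_succ.le.trans h2⟩
      have m2 : MemBar I i.succ := ⟨h1.trans Fin.castSucc_lt_succ.le, h2⟩
      have hc : (if MemBar I i.castSucc then (1 : F) else 0) =
          if MemBar I i.succ then (1 : F) else 0 := by rw [if_pos m1, if_pos m2]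
      exact (mem_graph_intervalModule _ _ _ _ _).2 ⟨fun _ _ => hc, fun _ _ => hc⟩
    have hone : Module.finrank F ((intervalModule F τ J).sections I) = 1 := by
      refine (finrank_eq_one_iff_of_nonzero' ⟨v, hv⟩ fun h0 => ?_).2 fun w => ?_
      · have h1 : v I.1.1 = 0 := congrFun (congrArg Subtype.val h0) I.1.1
        have h2 : (if MemBar I I.1.1 then (1 : F) else 0) = 0 := congrArg Subtype.val h1
        rw [if_pos ⟨le_rfl, I.2⟩] at h2
        exact one_ne_zero h2
      · refine ⟨intervalCoord τ J _ (w.1 I.1.1), Subtype.ext (funext fun i =>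
          Subtype.ext ?_)⟩
        change intervalCoord τ J _ (w.1 I.1.1) * (if MemBar I i then (1 : F) else 0) =
          intervalCoord τ J i (w.1 i)
        by_cases hi : MemBar I i
        · rw [if_pos hi, mul_one, hconst w.1 w.2 i hi]
        · rw [if_neg hi, mul_zero, w.2.2 i hi]
          rfl
    rw [hone]
    rfl
  · refine barRank_eq_zero_of_forall_apply_eq_zero ?_
    by_cases h1 : MemBar J I.1.1
    · have h2 : ¬ MemBar J I.1.2 := fun h2 => h ⟨h1.1, h2.2⟩
      exact Or.inr fun x _ => Subtype.ext (coe_eq_zero_of_not_memBar h2 _)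
    · exact Or.inl fun x _ => Subtype.ext (coe_eq_zero_of_not_memBar h1 _)

theorem barRank_intervalSum (τ : Fin n → Dir) (D : List (Bar n)) (I : Bar n) :
    (intervalSum F τ D).barRank I = (D : Multiset (Bar n)).countP (BarLE I) := by
  induction D with
  | nil =>
    rw [barRank_of_subsingleton fun i => inferInstanceAs (Subsingleton PUnit)]
    simp
  | cons J D ih =>
    rw [(isGraphSum_intervalSum_cons τ J D).barRank_eq, ih, barRank_intervalModule,
      ← Multiset.cons_coe, Multiset.countP_cons]
    push_cast
    ring

/-- A finite multiset of intervals is determined by the numbers of its members that contain a given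
interval. -/
theorem eq_of_countP_barLE_eq {D D' : Multiset (Bar n)}
    (h : ∀ I, D.countP (BarLE I) = D'.countP (BarLE I)) : D = D' := by
  have hsum : ∀ (E : Multiset (Bar n)) (I : Bar n),
      E.countP (BarLE I) = ∑ J ∈ Finset.univ.filter (BarLE I), E.count J := by
    intro E I
    rw [Multiset.countP_eq_card_filter, ← Multiset.sum_count_eq_card (s := Finset.univ)
      (fun _ _ => Finset.mem_univ _), Finset.sum_filter]
    exact Finset.sum_congr rfl fun J _ => Multiset.count_filter
  ext I
  -- downward induction on the length of the interval
  induction hm : n - (I.1.2.val - I.1.1.val) using Nat.strong_induction_on generalizing I with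
  | _ m ih =>
    have hI := h I
    have hmem : I ∈ Finset.univ.filter (BarLE I) := by simp [BarLE]
    rw [hsum, hsum, ← Finset.add_sum_erase _ _ hmem, ← Finset.add_sum_erase _ _ hmem,
      Finset.sum_congr rfl (g := fun J => D'.count J)] at hI
    · exact Nat.add_right_cancel hI
    · intro J hJ
      rw [Finset.mem_erase, Finset.mem_filter] at hJ
      obtain ⟨hne, -, hJ1, hJ2⟩ := hJ
      refine ih _ ?_ J rfl
      have h1 := I.2
      have h2 := J.1.2.isLt
      have hne' : ¬ (J.1.1.val = I.1.1.val ∧ J.1.2.val = I.1.2.val) := fun hc =>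
        hne (Subtype.ext (Prod.ext (Fin.ext hc.1) (Fin.ext hc.2)))
      rw [Fin.le_def] at h1 hJ1 hJ2
      omega

theorem isomorphic_dgm (V : ZigzagModule F n) :
    Isomorphic V (intervalSum F V.type V.exists_isomorphic_intervalSum.choose) ∧
      V.dgm = (V.exists_isomorphic_intervalSum.choose : Multiset (Bar n)) :=
  ⟨V.exists_isomorphic_intervalSum.choose_spec, dif_pos _⟩

theorem barRank_eq_countP_dgm (V : ZigzagModule F n) (I : Bar n) :
    V.barRank I = V.dgm.countP (BarLE I) := by
  obtain ⟨h1, h2⟩ := V.isomorphic_dgm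
  rw [h2, (isomorphic_iff.1 h1).2.barRank_eq, barRank_intervalSum]

theorem dgm_intervalSum (τ : Fin n → Dir) (D : List (Bar n)) :
    (intervalSum F τ D).dgm = D := by
  refine eq_of_countP_barLE_eq fun I => ?_
  have h := (intervalSum F τ D).barRank_eq_countP_dgm I
  rw [barRank_intervalSum] at h
  exact_mod_cast h.symm

theorem GraphIso.dgm_eq {V W : ZigzagModule F n} (h : GraphIso V W) : V.dgm = W.dgm := by
  refine eq_of_countP_barLE_eq fun I => ?_
  have h := h.barRank_eq I
  rw [barRank_eq_countP_dgm, barRank_eq_countP_dgm] at h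
  exact_mod_cast h

theorem IsGraphSum.dgm_eq {V W U : ZigzagModule F n} (h : IsGraphSum V W U) :
    V.dgm = W.dgm + U.dgm := by
  refine eq_of_countP_barLE_eq fun I => ?_
  have h := h.barRank_eq I
  rw [barRank_eq_countP_dgm, barRank_eq_countP_dgm, barRank_eq_countP_dgm] at h
  rw [Multiset.countP_add]
  exact_mod_cast h

end ZigzagModule

/-! ### Removing the simple summands -/

namespace ZigzagModule

variable {F : Type u} [Field F] {n : ℕ}

theorem graphIso_intervalSum_of_perm (τ : Fin n → Dir) {D D' : List (Bar n)} (h : D.Perm D') :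
    GraphIso (intervalSum F τ D) (intervalSum F τ D') := by
  induction h with
  | nil => exact GraphIso.refl _
  | cons I _ ih =>
    exact ((isGraphSum_intervalSum_cons τ I _).congr_right ih).graphIso
      (isGraphSum_intervalSum_cons τ I _)
  | swap I J D =>
    obtain ⟨e₁, h₁⟩ := isGraphSum_intervalSum_cons (F := F) τ J (I :: D)
    obtain ⟨e₂, h₂⟩ := isGraphSum_intervalSum_cons (F := F) τ I D
    obtain ⟨e₃, h₃⟩ := isGraphSum_intervalSum_cons (F := F) τ I (J :: D)
    obtain ⟨e₄, h₄⟩ := isGraphSum_intervalSum_cons (F := F) τ J D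
    refine IsGraphSum.graphIso (W := intervalModule F τ I) (U := intervalSum F τ (J :: D))
      ⟨fun i => (e₁ i).trans ((((LinearEquiv.refl F _).prodCongr (e₂ i)).trans
        (LinearEquiv.prodAssoc F _ _ _).symm).trans ((((LinearEquiv.prodComm F _ _).prodCongr
          (LinearEquiv.refl F _)).trans (LinearEquiv.prodAssoc F _ _ _)).trans
            ((LinearEquiv.refl F _).prodCongr (e₄ i).symm))), fun i x y => ?_⟩ ⟨e₃, h₃⟩
    rw [h₁ i x y, h₂ i, h₄ i, and_left_comm]
    simp only [LinearEquiv.trans_apply, LinearEquiv.prodCongr_apply, LinearEquiv.refl_apply,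
      LinearEquiv.apply_symm_apply]
    exact Iff.rfl
  | trans _ _ ih₁ ih₂ => exact ih₁.trans ih₂

theorem graphIso_intervalSum_dgm (V : ZigzagModule F n) {D : List (Bar n)} (h : V.dgm = D) :
    GraphIso V (intervalSum F V.type D) := by
  obtain ⟨h1, h2⟩ := V.isomorphic_dgm
  exact (isomorphic_iff.1 h1).2.trans
    (graphIso_intervalSum_of_perm _ (Multiset.coe_eq_coe.1 (h2.symm.trans h)))

theorem isGraphSum_of_dgm_eq_add {V : ZigzagModule F n} {D D' : List (Bar n)}
    (h : V.dgm = D + D') :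
    IsGraphSum V (intervalSum F V.type D) (intervalSum F V.type D') := by
  have ht : (intervalSum F V.type D).type = (intervalSum F V.type D').type := by
    rw [type_intervalSum, type_intervalSum]
  have hs := isGraphSum_directSum ht
  have hd := hs.dgm_eq
  rw [dgm_intervalSum, dgm_intervalSum, Multiset.coe_add] at hd
  have hg := graphIso_intervalSum_dgm _ hd
  rw [type_directSum ht, type_intervalSum] at hg
  rw [Multiset.coe_add] at h
  exact hs.congr_left (hg.trans (graphIso_intervalSum_dgm V h).symm)

theorem subsingleton_intervalSpace_iff {I : Bar n} {i : Fin (n + 1)} :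
    Subsingleton (intervalSpace F I i) ↔ ¬ MemBar I i := by
  constructor
  · intro h hi
    have : (⟨1, mem_intervalSpace hi 1⟩ : intervalSpace F I i) = 0 := Subsingleton.elim _ _
    exact one_ne_zero (congrArg Subtype.val this)
  · intro h
    exact ⟨fun x y => Subtype.ext (by
      rw [coe_eq_zero_of_not_memBar h, coe_eq_zero_of_not_memBar h])⟩

theorem _root_.ZArrow.IsIso.subsingleton_iff {A B : Type u} [AddCommGroup A] [Module F A]
    [AddCommGroup B] [Module F B] {a : ZArrow F A B} (h : a.IsIso) :
    Subsingleton A ↔ Subsingleton B := by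
  cases a with
  | fwd f => exact (Equiv.ofBijective f h).subsingleton_congr
  | bwd f => exact (Equiv.ofBijective f h).subsingleton_congr.symm

/-- No interval of the diagram is cut by a structure map that is an isomorphism. -/
theorem memBar_iff_of_isIso {V : ZigzagModule F n} {i : Fin n} (hi : (V.arrow i).IsIso)
    {I : Bar n} (hI : I ∈ V.dgm) : MemBar I i.castSucc ↔ MemBar I i.succ := by
  classical
  have hD : V.dgm = (I :: (V.dgm.erase I).toList : List (Bar n)) := by
    rw [← Multiset.cons_coe, Multiset.coe_toList, Multiset.cons_erase hI]
  have hs := (isGraphSum_intervalSum_cons (F := F) V.type I _).congr_left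
    (V.graphIso_intervalSum_dgm hD).symm
  have := (hs.isIso_of_isIso hi).subsingleton_iff
  exact not_iff_not.1 (subsingleton_intervalSpace_iff.symm.trans
    (this.trans subsingleton_intervalSpace_iff))

/-- The type of a sum of interval modules can be changed at the arrows that cut none of the
intervals. -/
theorem graphIso_intervalSum_of_forall_memBar_iff {τ τ' : Fin n → Dir} {D : List (Bar n)}
    (h : ∀ i, τ i ≠ τ' i → ∀ I ∈ D, (MemBar I i.castSucc ↔ MemBar I i.succ)) :
    GraphIso (intervalSum F τ D) (intervalSum F τ' D) := by
  induction D with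
  | nil =>
    exact graphIso_of_subsingleton (fun i => inferInstanceAs (Subsingleton PUnit))
      fun i => inferInstanceAs (Subsingleton PUnit)
  | cons I D ih =>
    have hI : GraphIso (intervalModule F τ I) (intervalModule F τ' I) := by
      refine ⟨fun i => LinearEquiv.refl F (intervalSpace F I i), fun i x y => ?_⟩
      refine (mem_graph_intervalModule τ I i x y).trans
        (Iff.trans ?_ (mem_graph_intervalModule τ' I i x y).symm)
      by_cases hi : τ i = τ' i
      · rw [hi]
      · have hm := h i hi I (List.mem_cons_self)
        cases h1 : τ i <;> cases h2 : τ' i <;> simp_all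
    exact (((isGraphSum_intervalSum_cons τ I D).congr_mid hI).congr_right
      (ih fun i hi J hJ => h i hi J (List.mem_cons_of_mem _ hJ))).graphIso
        (isGraphSum_intervalSum_cons τ' I D)

theorem type_removeSimple (V : ZigzagModule F n) : V.removeSimple.type = V.type :=
  type_intervalSum _ _

theorem dgm_removeSimple (V : ZigzagModule F n) :
    V.removeSimple.dgm = V.dgm.filter fun I => I.1.1 ≠ I.1.2 := by
  rw [removeSimple, dgm_intervalSum, Multiset.coe_toList]

theorem removeSimple_removeSimple (V : ZigzagModule F n) :
    V.removeSimple.removeSimple = V.removeSimple := by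
  conv_lhs => rw [removeSimple, dgm_removeSimple, type_removeSimple, Multiset.filter_filter]
  simp only [and_self]
  rfl

theorem exists_isGraphSum_removeSimple (V : ZigzagModule F n) :
    ∃ U, IsGraphSum V V.removeSimple U := by
  refine ⟨_, isGraphSum_of_dgm_eq_add (V := V)
    (D' := (V.dgm.filter fun I => ¬ (I.1.1 ≠ I.1.2)).toList) ?_⟩
  rw [Multiset.coe_toList, Multiset.coe_toList, Multiset.filter_add_not]

theorem precsim_removeSimple_self (V : ZigzagModule F n) : Precsim V.removeSimple V :=
  precsim_iff.2 V.exists_isGraphSum_removeSimple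

/-- Removing the simple summands is monotone: a summand `X` of `W` has a smaller diagram, and the
arrows at which the types of `X` and `W` differ cut none of the intervals of `X`. -/
theorem Precsim.removeSimple {X W : ZigzagModule F n} (h : Precsim X W) :
    Precsim X.removeSimple W.removeSimple := by
  obtain ⟨U, hU⟩ := precsim_iff.1 h
  have hd : W.removeSimple.dgm =
      ((X.dgm.filter fun I => I.1.1 ≠ I.1.2).toList : Multiset (Bar n)) +
        ((U.dgm.filter fun I => I.1.1 ≠ I.1.2).toList : Multiset (Bar n)) := by
    rw [dgm_removeSimple, hU.dgm_eq, Multiset.filter_add, Multiset.coe_toList,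
      Multiset.coe_toList]
  refine precsim_iff.2 ⟨_, (isGraphSum_of_dgm_eq_add hd).congr_mid
    (graphIso_intervalSum_of_forall_memBar_iff fun i hi I hI => ?_)⟩
  rw [type_removeSimple] at hi
  refine memBar_iff_of_isIso (hU.isIso_left hi.symm) ?_
  rw [Multiset.mem_toList] at hI
  exact Multiset.mem_of_mem_filter hI

end ZigzagModule

/-! ### Reflections preserve direct sums -/

namespace ZArrow

variable {F : Type u} [Field F] {A B C A₁ B₁ C₁ A₂ B₂ C₂ : Type u}
  [AddCommGroup A] [Module F A] [AddCommGroup B] [Module F B] [AddCommGroup C] [Module F C]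
  [AddCommGroup A₁] [Module F A₁] [AddCommGroup B₁] [Module F B₁]
  [AddCommGroup C₁] [Module F C₁]
  [AddCommGroup A₂] [Module F A₂] [AddCommGroup B₂] [Module F B₂]
  [AddCommGroup C₂] [Module F C₂]

theorem mem_limit {a : ZArrow F A B} {b : ZArrow F B C} {v : A × B × C} :
    v ∈ limit a b ↔ (v.1, v.2.1) ∈ a.graph ∧ (v.2.1, v.2.2) ∈ b.graph :=
  Iff.rfl

theorem mem_colimitRel {a : ZArrow F A B} {b : ZArrow F B C} {v : A × B × C} :
    v ∈ colimitRel a b ↔ ∃ y y', (v.1, y) ∈ a.graph ∧ (y', -v.2.2) ∈ b.graph ∧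
      v.2.1 = -y + y' := by
  rw [colimitRel, Submodule.mem_sup]
  constructor
  · rintro ⟨_, ⟨⟨x, y⟩, h, rfl⟩, _, ⟨⟨y', z⟩, h', rfl⟩, rfl⟩
    exact ⟨y, y', by simpa using h, by simpa using h', by simp⟩
  · obtain ⟨x, w, z⟩ := v
    rintro ⟨y, y', h, h', hw⟩
    refine ⟨_, ⟨(x, y), h, rfl⟩, _, ⟨(y', -z), h', rfl⟩, ?_⟩
    simp only at hw
    simp [hw]

/-- The isomorphism of `A × B × C` with the product of `A₁ × B₁ × C₁` and `A₂ × B₂ × C₂` induced by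
isomorphisms of the factors. -/
def tripleEquiv (eA : A ≃ₗ[F] A₁ × A₂) (eB : B ≃ₗ[F] B₁ × B₂) (eC : C ≃ₗ[F] C₁ × C₂) :
    (A × B × C) ≃ₗ[F] (A₁ × B₁ × C₁) × (A₂ × B₂ × C₂) where
  toFun v := (((eA v.1).1, (eB v.2.1).1, (eC v.2.2).1), ((eA v.1).2, (eB v.2.1).2, (eC v.2.2).2))
  invFun w := (eA.symm (w.1.1, w.2.1), eB.symm (w.1.2.1, w.2.2.1), eC.symm (w.1.2.2, w.2.2.2))
  map_add' v w := by simp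
  map_smul' c v := by simp
  left_inv v := by simp
  right_inv w := by simp

variable {eA : A ≃ₗ[F] A₁ × A₂} {eB : B ≃ₗ[F] B₁ × B₂} {eC : C ≃ₗ[F] C₁ × C₂}
  {a : ZArrow F A B} {a₁ : ZArrow F A₁ B₁} {a₂ : ZArrow F A₂ B₂}
  {b : ZArrow F B C} {b₁ : ZArrow F B₁ C₁} {b₂ : ZArrow F B₂ C₂}

theorem mem_limit_iff_tripleEquiv (ha : SumCompat eA eB a a₁ a₂) (hb : SumCompat eB eC b b₁ b₂)
    (v : A × B × C) : v ∈ limit a b ↔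
      (tripleEquiv eA eB eC v).1 ∈ limit a₁ b₁ ∧ (tripleEquiv eA eB eC v).2 ∈ limit a₂ b₂ := by
  rw [mem_limit, mem_limit, mem_limit, ha, hb, and_and_and_comm]
  rfl

theorem mem_colimitRel_iff_tripleEquiv (ha : SumCompat eA eB a a₁ a₂)
    (hb : SumCompat eB eC b b₁ b₂) (v : A × B × C) : v ∈ colimitRel a b ↔
      (tripleEquiv eA eB eC v).1 ∈ colimitRel a₁ b₁ ∧
        (tripleEquiv eA eB eC v).2 ∈ colimitRel a₂ b₂ := by
  rw [mem_colimitRel, mem_colimitRel, mem_colimitRel]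
  constructor
  · rintro ⟨y, y', h, h', hw⟩
    rw [ha] at h
    rw [hb, map_neg] at h'
    have hw' := congrArg eB hw
    rw [map_add, map_neg] at hw'
    exact ⟨⟨_, _, h.1, h'.1, congrArg Prod.fst hw'⟩, ⟨_, _, h.2, h'.2, congrArg Prod.snd hw'⟩⟩
  · rintro ⟨⟨y₁, y₁', h₁, h₁', hw₁⟩, ⟨y₂, y₂', h₂, h₂', hw₂⟩⟩
    refine ⟨eB.symm (y₁, y₂), eB.symm (y₁', y₂'), ?_, ?_, ?_⟩
    · rw [ha]
      simpa using ⟨h₁, h₂⟩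
    · rw [hb, map_neg]
      simpa using ⟨h₁', h₂'⟩
    · apply eB.injective
      rw [map_add, map_neg, LinearEquiv.apply_symm_apply, LinearEquiv.apply_symm_apply]
      exact Prod.ext hw₁ hw₂

/-- The limit of a direct sum of diagrams is the direct sum of the limits. -/
def limitSumEquiv (ha : SumCompat eA eB a a₁ a₂) (hb : SumCompat eB eC b b₁ b₂) :
    limit a b ≃ₗ[F] limit a₁ b₁ × limit a₂ b₂ where
  toFun v := (⟨(tripleEquiv eA eB eC v).1, ((mem_limit_iff_tripleEquiv ha hb _).1 v.2).1⟩,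
    ⟨(tripleEquiv eA eB eC v).2, ((mem_limit_iff_tripleEquiv ha hb _).1 v.2).2⟩)
  invFun w := ⟨(tripleEquiv eA eB eC).symm (w.1, w.2), (mem_limit_iff_tripleEquiv ha hb _).2
    (by rw [LinearEquiv.apply_symm_apply]; exact ⟨w.1.2, w.2.2⟩)⟩
  map_add' v w := by ext <;> simp
  map_smul' c v := by ext <;> simp
  left_inv v := by ext <;> simp
  right_inv w := by ext <;> simp

/-- The colimit of a direct sum of diagrams is the direct sum of the colimits. -/
noncomputable def colimitSumEquiv (ha : SumCompat eA eB a a₁ a₂) (hb : SumCompat eB eC b b₁ b₂) :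
    colimit a b ≃ₗ[F] colimit a₁ b₁ × colimit a₂ b₂ :=
  (Submodule.quotEquivOfEq _ _ (by
    ext v
    rw [mem_colimitRel_iff_tripleEquiv ha hb]
    simp [Prod.ext_iff])).trans
  (LinearMap.quotKerEquivOfSurjective
    (((colimitRel a₁ b₁).mkQ.prodMap (colimitRel a₂ b₂).mkQ) ∘ₗ
      (tripleEquiv eA eB eC).toLinearMap)
    (((Submodule.mkQ_surjective _).prodMap (Submodule.mkQ_surjective _)).comp
      (tripleEquiv eA eB eC).surjective))

theorem colimitSumEquiv_mkQ (ha : SumCompat eA eB a a₁ a₂) (hb : SumCompat eB eC b b₁ b₂)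
    (v : A × B × C) : colimitSumEquiv ha hb ((colimitRel a b).mkQ v) =
      ((colimitRel a₁ b₁).mkQ (tripleEquiv eA eB eC v).1,
        (colimitRel a₂ b₂).mkQ (tripleEquiv eA eB eC v).2) :=
  rfl

theorem colimitSumEquiv_inl (ha : SumCompat eA eB a a₁ a₂) (hb : SumCompat eB eC b b₁ b₂) {x : A}
    {x₁ : A₁} {x₂ : A₂} (hx : eA x = (x₁, x₂)) :
    colimitSumEquiv ha hb ((colimitRel a b).mkQ (LinearMap.inl F _ _ x)) =
      ((colimitRel a₁ b₁).mkQ (LinearMap.inl F _ _ x₁),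
        (colimitRel a₂ b₂).mkQ (LinearMap.inl F _ _ x₂)) := by
  have h : tripleEquiv eA eB eC (LinearMap.inl F _ _ x) =
      (LinearMap.inl F _ _ x₁, LinearMap.inl F _ _ x₂) := by
    ext <;> simp [tripleEquiv, hx]
  rw [colimitSumEquiv_mkQ, h]

theorem colimitSumEquiv_inr (ha : SumCompat eA eB a a₁ a₂) (hb : SumCompat eB eC b b₁ b₂) {z : C}
    {z₁ : C₁} {z₂ : C₂} (hz : eC z = (z₁, z₂)) :
    colimitSumEquiv ha hb ((colimitRel a b).mkQ (LinearMap.inr F _ _ (LinearMap.inr F _ _ z))) =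
      ((colimitRel a₁ b₁).mkQ (LinearMap.inr F _ _ (LinearMap.inr F _ _ z₁)),
        (colimitRel a₂ b₂).mkQ (LinearMap.inr F _ _ (LinearMap.inr F _ _ z₂))) := by
  have h : tripleEquiv eA eB eC (LinearMap.inr F _ _ (LinearMap.inr F _ _ z)) =
      (LinearMap.inr F _ _ (LinearMap.inr F _ _ z₁),
        LinearMap.inr F _ _ (LinearMap.inr F _ _ z₂)) := by
    ext <;> simp [tripleEquiv, hz]
  rw [colimitSumEquiv_mkQ, h]

theorem sumCompat_fwd {f : A →ₗ[F] B} {f₁ : A₁ →ₗ[F] B₁} {f₂ : A₂ →ₗ[F] B₂}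
    (h : ∀ x, eB (f x) = (f₁ (eA x).1, f₂ (eA x).2)) :
    SumCompat eA eB (fwd f) (fwd f₁) (fwd f₂) := by
  intro x y
  rw [mem_graph_fwd, mem_graph_fwd, mem_graph_fwd, ← eB.injective.eq_iff, h, Prod.ext_iff]

theorem sumCompat_bwd {f : B →ₗ[F] A} {f₁ : B₁ →ₗ[F] A₁} {f₂ : B₂ →ₗ[F] A₂}
    (h : ∀ x, eA (f x) = (f₁ (eB x).1, f₂ (eB x).2)) :
    SumCompat eA eB (bwd f) (bwd f₁) (bwd f₂) := by
  intro x y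
  rw [mem_graph_bwd, mem_graph_bwd, mem_graph_bwd, ← eA.injective.eq_iff, h, Prod.ext_iff]

end ZArrow

namespace ZigzagModule

variable {F : Type u} [Field F] {n : ℕ}

theorem leftNbr_zero (V : ZigzagModule F n) (c : Dir) :
    V.leftNbr c 0 = ⟨FGModuleCat.of F PUnit.{u + 1}, ZArrow.zero c⟩ := by
  simp [leftNbr]

theorem rightNbr_last (V : ZigzagModule F n) (c : Dir) :
    V.rightNbr c (Fin.last n) = ⟨FGModuleCat.of F PUnit.{u + 1}, ZArrow.zero c⟩ := by
  simp [rightNbr]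

/-- Transport of a graph along an equality of pairs of a space and an arrow from it. -/
theorem mem_graph_left_congr {B : FGModuleCat.{u} F} {σ σ' : Σ A : FGModuleCat.{u} F, ZArrow F A B}
    (h : σ = σ') (x : σ.1) (y : B) :
    (x, y) ∈ σ.2.graph ↔ (castEquiv (congrArg Sigma.fst h) x, y) ∈ σ'.2.graph := by
  subst h
  rfl

/-- Transport of a graph along an equality of pairs of a space and an arrow to it. -/
theorem mem_graph_right_congr {A : FGModuleCat.{u} F}
    {σ σ' : Σ B : FGModuleCat.{u} F, ZArrow F A B} (h : σ = σ') (x : A) (y : σ.1) :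
    (x, y) ∈ σ.2.graph ↔ (x, castEquiv (congrArg Sigma.fst h) y) ∈ σ'.2.graph := by
  subst h
  rfl

theorem mem_graph_leftNbr_succ (V : ZigzagModule F n) (c : Dir) (i : Fin n)
    (x : (V.leftNbr c i.succ).1) (y : V.space i.succ) :
    (x, y) ∈ (V.leftNbr c i.succ).2.graph ↔ (V.leftEquiv c i x, y) ∈ (V.arrow i).graph :=
  mem_graph_left_congr (V.leftNbr_succ c i) x y

theorem mem_graph_rightNbr_castSucc (V : ZigzagModule F n) (c : Dir) (i : Fin n)
    (x : V.space i.castSucc) (y : (V.rightNbr c i.castSucc).1) :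
    (x, y) ∈ (V.rightNbr c i.castSucc).2.graph ↔ (x, V.rightEquiv c i y) ∈ (V.arrow i).graph :=
  mem_graph_right_congr (V.rightNbr_castSucc c i) x y

theorem mem_graph_leftNbr_zero (V : ZigzagModule F n) (c : Dir) (x : (V.leftNbr c 0).1)
    (y : V.space 0) : (x, y) ∈ (V.leftNbr c 0).2.graph ↔ (c = Dir.right → y = 0) := by
  refine (mem_graph_left_congr (V.leftNbr_zero c) x y).trans ?_
  cases c
  · exact (ZArrow.mem_graph_fwd _ _ _).trans (by simp [eq_comm])
  · exact (ZArrow.mem_graph_bwd _ _ _).trans (by simp)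

theorem mem_graph_rightNbr_last (V : ZigzagModule F n) (c : Dir) (x : V.space (Fin.last n))
    (y : (V.rightNbr c (Fin.last n)).1) :
    (x, y) ∈ (V.rightNbr c (Fin.last n)).2.graph ↔ (c = Dir.left → x = 0) := by
  refine (mem_graph_right_congr (V.rightNbr_last c) x y).trans ?_
  cases c
  · exact (ZArrow.mem_graph_fwd _ _ _).trans (by simp)
  · exact (ZArrow.mem_graph_bwd _ _ _).trans (by simp [eq_comm])

theorem subsingleton_leftNbr_zero (V : ZigzagModule F n) (c : Dir) :
    Subsingleton (V.leftNbr c 0).1 := by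
  rw [leftNbr_zero]
  exact inferInstanceAs (Subsingleton PUnit)

theorem subsingleton_rightNbr_last (V : ZigzagModule F n) (c : Dir) :
    Subsingleton (V.rightNbr c (Fin.last n)).1 := by
  rw [rightNbr_last]
  exact inferInstanceAs (Subsingleton PUnit)

section

variable {V W U : ZigzagModule F n} {e : ∀ i, V.space i ≃ₗ[F] (W.space i × U.space i)}

/-- The left neighbours of a direct sum, including the zero space added at the first index, are
direct sums of the left neighbours of the summands. -/
theorem exists_leftNbr_sumCompat
    (he : ∀ i : Fin n, ZArrow.SumCompat (e i.castSucc) (e i.succ) (V.arrow i) (W.arrow i)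
      (U.arrow i)) (c : Dir) :
    ∃ E : ∀ k, (V.leftNbr c k).1 ≃ₗ[F] ((W.leftNbr c k).1 × (U.leftNbr c k).1),
      (∀ k, ZArrow.SumCompat (E k) (e k) (V.leftNbr c k).2 (W.leftNbr c k).2 (U.leftNbr c k).2) ∧
      ∀ i x, e i.castSucc (V.leftEquiv c i x) =
        (W.leftEquiv c i (E i.succ x).1, U.leftEquiv c i (E i.succ x).2) := by
  have hV := V.subsingleton_leftNbr_zero c
  have hW := W.subsingleton_leftNbr_zero c
  have hU := U.subsingleton_leftNbr_zero c
  refine ⟨Fin.cases 0 fun i => ((V.leftEquiv c i).trans (e i.castSucc)).trans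
    ((W.leftEquiv c i).symm.prodCongr (U.leftEquiv c i).symm), fun k => ?_, fun i x => ?_⟩
  · refine Fin.cases ?_ (fun i => ?_) k
    · intro x y
      rw [mem_graph_leftNbr_zero, mem_graph_leftNbr_zero, mem_graph_leftNbr_zero, ← imp_and,
        ← (e 0).map_eq_zero_iff, Prod.ext_iff]
      rfl
    · intro x y
      rw [mem_graph_leftNbr_succ, mem_graph_leftNbr_succ, mem_graph_leftNbr_succ, he i]
      simp
  · simp

/-- The right neighbours of a direct sum, including the zero space added at the last index, are
direct sums of the right neighbours of the summands. -/
theorem exists_rightNbr_sumCompat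
    (he : ∀ i : Fin n, ZArrow.SumCompat (e i.castSucc) (e i.succ) (V.arrow i) (W.arrow i)
      (U.arrow i)) (c : Dir) :
    ∃ E : ∀ k, (V.rightNbr c k).1 ≃ₗ[F] ((W.rightNbr c k).1 × (U.rightNbr c k).1),
      (∀ k, ZArrow.SumCompat (e k) (E k) (V.rightNbr c k).2 (W.rightNbr c k).2
        (U.rightNbr c k).2) ∧
      ∀ i x, e i.succ (V.rightEquiv c i x) =
        (W.rightEquiv c i (E i.castSucc x).1, U.rightEquiv c i (E i.castSucc x).2) := by
  have hV := V.subsingleton_rightNbr_last c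
  have hW := W.subsingleton_rightNbr_last c
  have hU := U.subsingleton_rightNbr_last c
  refine ⟨Fin.lastCases 0 fun i => ((V.rightEquiv c i).trans (e i.succ)).trans
    ((W.rightEquiv c i).symm.prodCongr (U.rightEquiv c i).symm), fun k => ?_, fun i x => ?_⟩
  · refine Fin.lastCases ?_ (fun i => ?_) k
    · intro x y
      rw [mem_graph_rightNbr_last, mem_graph_rightNbr_last, mem_graph_rightNbr_last, ← imp_and,
        ← (e _).map_eq_zero_iff, Prod.ext_iff]
      rfl
    · intro x y
      rw [mem_graph_rightNbr_castSucc, mem_graph_rightNbr_castSucc, mem_graph_rightNbr_castSucc,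
        he i]
      simp
  · simp

end

theorem IsGraphSum.extroversion {V W U : ZigzagModule F n} (h : IsGraphSum V W U)
    (k : Fin (n + 1)) (c : Dir) :
    IsGraphSum (V.extroversion k c) (W.extroversion k c) (U.extroversion k c) := by
  obtain ⟨e, he⟩ := h
  obtain ⟨L, hL, hL'⟩ := exists_leftNbr_sumCompat he c
  obtain ⟨R, hR, hR'⟩ := exists_rightNbr_sumCompat he c
  let E : ∀ (i : Fin (n + 1)) (s : Bool),
      V.extroSpace c i s ≃ₗ[F] (W.extroSpace c i s × U.extroSpace c i s) := fun i s =>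
    match s with
    | true => ZArrow.limitSumEquiv (hL i) (hR i)
    | false => e i
  suffices H : ∀ (i : Fin n) (s t : Bool), ZArrow.SumCompat (E i.castSucc s) (E i.succ t)
      (V.extroArrow c i s t) (W.extroArrow c i s t) (U.extroArrow c i s t) from
    ⟨fun i => E i _, fun i => H i _ _⟩
  intro i s t
  cases s <;> cases t
  · exact he i
  · exact ZArrow.sumCompat_bwd fun x => hL' i _
  · exact ZArrow.sumCompat_fwd fun x => hR' i _
  · exact ZArrow.sumCompat_fwd fun x => map_zero _

theorem IsGraphSum.introversion {V W U : ZigzagModule F n} (h : IsGraphSum V W U)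
    (k : Fin (n + 1)) (c : Dir) :
    IsGraphSum (V.introversion k c) (W.introversion k c) (U.introversion k c) := by
  obtain ⟨e, he⟩ := h
  obtain ⟨L, hL, hL'⟩ := exists_leftNbr_sumCompat he c
  obtain ⟨R, hR, hR'⟩ := exists_rightNbr_sumCompat he c
  let E : ∀ (i : Fin (n + 1)) (s : Bool),
      V.introSpace c i s ≃ₗ[F] (W.introSpace c i s × U.introSpace c i s) := fun i s =>
    match s with
    | true => ZArrow.colimitSumEquiv (hL i) (hR i)
    | false => e i
  suffices H : ∀ (i : Fin n) (s t : Bool), ZArrow.SumCompat (E i.castSucc s) (E i.succ t)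
      (V.introArrow c i s t) (W.introArrow c i s t) (U.introArrow c i s t) from
    ⟨fun i => E i _, fun i => H i _ _⟩
  intro i s t
  cases s <;> cases t
  · exact he i
  · refine ZArrow.sumCompat_fwd fun (x : V.space i.castSucc) => ?_
    have hx := hL' i ((V.leftEquiv c i).symm x)
    rw [LinearEquiv.apply_symm_apply] at hx
    refine ZArrow.colimitSumEquiv_inl (hL i.succ) (hR i.succ)
      (x := (V.leftEquiv c i).symm x) (x₁ := (W.leftEquiv c i).symm (e i.castSucc x).1)
      (x₂ := (U.leftEquiv c i).symm (e i.castSucc x).2) ?_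
    rw [hx]
    simp
  · refine ZArrow.sumCompat_bwd fun (x : V.space i.succ) => ?_
    have hx := hR' i ((V.rightEquiv c i).symm x)
    rw [LinearEquiv.apply_symm_apply] at hx
    refine ZArrow.colimitSumEquiv_inr (hL i.castSucc) (hR i.castSucc)
      (z := (V.rightEquiv c i).symm x) (z₁ := (W.rightEquiv c i).symm (e i.succ x).1)
      (z₂ := (U.rightEquiv c i).symm (e i.succ x).2) ?_
    rw [hx]
    simp
  · exact ZArrow.sumCompat_fwd fun x => map_zero _

/-- Reflections are monotone for `≾`, as they commute with direct sums up to arrow reversal. -/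
theorem Precsim.reflect {X W : ZigzagModule F n} (h : Precsim X W) (r : Reflection n) :
    Precsim (ZigzagModule.reflect r X) (ZigzagModule.reflect r W) := by
  obtain ⟨U, hU⟩ := precsim_iff.1 h
  cases r with
  | extro k c => exact precsim_iff.2 ⟨_, hU.extroversion k c⟩
  | intro k c => exact precsim_iff.2 ⟨_, hU.introversion k c⟩

end ZigzagModule

/-! ### Sequences of reflections -/

namespace ZigzagModule

variable {F : Type u} [Field F] {n : ℕ}

theorem applySeq_append (R S : List (Reflection n)) (V : ZigzagModule F n) :
    applySeq (R ++ S) V = S.foldl (fun X r => (reflect r X).removeSimple) (applySeq R V) :=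
  List.foldl_append

theorem applySeq_concat (R : List (Reflection n)) (r : Reflection n) (V : ZigzagModule F n) :
    applySeq (R ++ [r]) V = (reflect r (applySeq R V)).removeSimple :=
  applySeq_append R [r] V

theorem removeSimple_applySeq (R : List (Reflection n)) (V : ZigzagModule F n) :
    (applySeq R V).removeSimple = applySeq R V := by
  induction R using List.reverseRecOn with
  | nil => exact V.removeSimple_removeSimple
  | append_singleton R r _ => rw [applySeq_concat, removeSimple_removeSimple]

theorem Precsim.foldl {X W : ZigzagModule F n} (h : Precsim X W) (S : List (Reflection n)) :
    Precsim (S.foldl (fun X r => (ZigzagModule.reflect r X).removeSimple) X)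
      (S.foldl (fun X r => (ZigzagModule.reflect r X).removeSimple) W) := by
  induction S generalizing X W with
  | nil => exact h
  | cons r S ih => exact ih (h.reflect r).removeSimple

/-- Sequences of reflections compose: this gives the triangle inequality. -/
theorem Precsim.applySeq_append {V W U : ZigzagModule F n} {R S : List (Reflection n)}
    (h : Precsim (applySeq R V) W) (h' : Precsim (applySeq S W) U) :
    Precsim (applySeq (R ++ S) V) U := by
  rw [ZigzagModule.applySeq_append]
  have h1 := h.removeSimple
  rw [removeSimple_applySeq] at h1
  exact (h1.foldl S).trans h'

/-! ### Annihilating a module by reflections -/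

theorem type_extroversion (V : ZigzagModule F n) (k : Fin (n + 1)) (c : Dir) (i : Fin n) :
    (V.extroversion k c).type i =
      if i.castSucc = k then Dir.right else if i.succ = k then Dir.left else V.type i := by
  have h : ∀ s t : Bool, (V.extroArrow c i s t).dir =
      if s = true then Dir.right else if t = true then Dir.left else V.type i := by
    intro s t
    cases s <;> cases t <;> rfl
  refine (h (decide (i.castSucc = k)) (decide (i.succ = k))).trans ?_
  simp only [decide_eq_true_eq]

theorem subsingleton_extroversion {V : ZigzagModule F n} {k : Fin (n + 1)} {c : Dir}
    {i : Fin (n + 1)} (h : i = k → Subsingleton (V.limitAt c i))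
    (h' : i ≠ k → Subsingleton (V.space i)) : Subsingleton ((V.extroversion k c).space i) := by
  have : ∀ s : Bool, (s = true → Subsingleton (V.limitAt c i)) →
      (s = false → Subsingleton (V.space i)) → Subsingleton (V.extroSpace c i s) := by
    intro s h1 h2
    cases s
    · exact h2 rfl
    · exact h1 rfl
  exact this (decide (i = k)) (fun hd => h (by simpa using hd)) fun hd => h' (by simpa using hd)

theorem subsingleton_removeSimple {V : ZigzagModule F n} {i : Fin (n + 1)}
    (h : Subsingleton (V.space i)) : Subsingleton (V.removeSimple.space i) := by
  obtain ⟨U, e, -⟩ := V.exists_isGraphSum_removeSimple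
  have := (e i).symm.toEquiv.subsingleton
  exact ⟨fun x y => congrArg Prod.fst
    (Subsingleton.elim (x, (0 : U.space i)) (y, (0 : U.space i)))⟩

/-- The limit of a diagram `A ← B ← 0` vanishes. -/
theorem subsingleton_limitAt {V : ZigzagModule F n} {k : Fin (n + 1)}
    (hl : ∀ i : Fin n, i.succ = k → V.type i = Dir.left)
    (hr : ∀ i : Fin n, i.castSucc = k → V.type i = Dir.left ∧ Subsingleton (V.space i.succ)) :
    Subsingleton (V.limitAt Dir.left k) := by
  have hR : Subsingleton (V.rightNbr Dir.left k).1 ∧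
      ∀ y z, (y, z) ∈ (V.rightNbr Dir.left k).2.graph → y = 0 := by
    clear hl
    induction k using Fin.lastCases with
    | last =>
      exact ⟨V.subsingleton_rightNbr_last _, fun y z h =>
        (V.mem_graph_rightNbr_last _ y z).1 h rfl⟩
    | cast i =>
      obtain ⟨hd, hs⟩ := hr i rfl
      refine ⟨(V.rightEquiv Dir.left i).toEquiv.subsingleton, fun y z h => ?_⟩
      rw [mem_graph_rightNbr_castSucc, Subsingleton.elim (V.rightEquiv Dir.left i z) 0] at h
      cases ha : V.arrow i with
      | fwd p => simp [type, ha, ZArrow.dir] at hd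
      | bwd p =>
        rw [ha, ZArrow.mem_graph_bwd, map_zero] at h
        exact h.symm
  have hL : ∀ x, (x, 0) ∈ (V.leftNbr Dir.left k).2.graph → x = 0 := by
    clear hr hR
    induction k using Fin.cases with
    | zero =>
      intro x _
      have := V.subsingleton_leftNbr_zero Dir.left
      exact Subsingleton.elim _ _
    | succ i =>
      intro x h
      have hd := hl i rfl
      rw [mem_graph_leftNbr_succ] at h
      cases ha : V.arrow i with
      | fwd p => simp [type, ha, ZArrow.dir] at hd
      | bwd p =>
        rw [ha, ZArrow.mem_graph_bwd, map_zero, eq_comm] at h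
        simpa using h
  obtain ⟨hR1, hR2⟩ := hR
  refine subsingleton_of_forall_eq (0 : ZArrow.limit _ _) ?_
  rintro ⟨⟨x, y, z⟩, h1, h2⟩
  have hy : y = 0 := hR2 y z h2
  subst hy
  have hx : x = 0 := hL x h1
  exact Subtype.ext (Prod.ext hx (Prod.ext rfl (Subsingleton.elim _ _)))

theorem exists_applySeq_type_eq_left (V : ZigzagModule F n) (m : ℕ) (hm : m ≤ n + 1) :
    ∃ R : List (Reflection n), ∀ i : Fin n, i.succ.val < m → (applySeq R V).type i = Dir.left := by
  induction m with
  | zero => exact ⟨[], fun i hi => absurd hi (Nat.not_lt_zero _)⟩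
  | succ m ih =>
    obtain ⟨R, hR⟩ := ih (by omega)
    -- the arrow to the right of `m` is turned to the right here and to the left in the next step
    refine ⟨R ++ [Reflection.extro ⟨m, by omega⟩ Dir.left], fun i hi => ?_⟩
    rw [applySeq_concat, type_removeSimple, reflect, type_extroversion, if_neg]
    · split_ifs with h
      · rfl
      · refine hR i ?_
        have : i.succ.val ≠ m := fun h' => h (Fin.ext h')
        omega
    · intro h
      have := congrArg Fin.val h
      simp only [Fin.val_castSucc, Fin.val_succ] at this hi
      omega

/-- Extroversions at `0, 1, …, n` make all arrows point to the left. After that, extroversions at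
`n, …, 1, 0` annihilate one space after the other, since `Vₖ` is then replaced by the limit of
`Vₖ₋₁ ← Vₖ ← 0`. -/
theorem exists_applySeq_subsingleton (V : ZigzagModule F n) :
    ∃ R : List (Reflection n), ∀ i, Subsingleton ((applySeq R V).space i) := by
  -- after `m` steps the spaces with index at least `q` vanish and the arrows before them, including
  -- the one between the indices `q - 1` and `q`, point to the left
  suffices H : ∀ m q : ℕ, m + q = n + 1 → ∃ R : List (Reflection n),
      (∀ i : Fin n, i.succ.val ≤ q → (applySeq R V).type i = Dir.left) ∧
        ∀ j : Fin (n + 1), q ≤ j.val → Subsingleton ((applySeq R V).space j) by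
    obtain ⟨R, -, hR⟩ := H (n + 1) 0 rfl
    exact ⟨R, fun i => hR i (Nat.zero_le _)⟩
  intro m
  induction m with
  | zero =>
    intro q hq
    obtain ⟨R, hR⟩ := V.exists_applySeq_type_eq_left (n + 1) le_rfl
    exact ⟨R, fun i _ => hR i i.succ.isLt, fun j hj => absurd j.isLt (by omega)⟩
  | succ m ih =>
    intro q hq
    obtain ⟨R, hR1, hR2⟩ := ih (q + 1) (by omega)
    refine ⟨R ++ [Reflection.extro ⟨q, by omega⟩ Dir.left], fun i hi => ?_, fun j hj => ?_⟩
    · rw [applySeq_concat, type_removeSimple, reflect, type_extroversion, if_neg]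
      · split_ifs with h
        · rfl
        · exact hR1 i (by omega)
      · intro h
        have := congrArg Fin.val h
        simp only [Fin.val_castSucc, Fin.val_succ] at this hi
        omega
    · rw [applySeq_concat]
      refine subsingleton_removeSimple (subsingleton_extroversion (fun h => ?_) fun h => ?_)
      · have hjq : j.val = q := congrArg Fin.val h
        refine subsingleton_limitAt (fun i hi => hR1 i ?_) fun i hi => ⟨hR1 i ?_, hR2 _ ?_⟩
        · rw [hi]
          omega
        · have := congrArg Fin.val hi
          simp only [Fin.val_castSucc, Fin.val_succ] at this ⊢
          omega
        · have := congrArg Fin.val hi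
          simp only [Fin.val_castSucc, Fin.val_succ] at this ⊢
          omega
      · refine hR2 j ?_
        have : j.val ≠ q := fun h' => h (Fin.ext h')
        omega

/-! ### The reflection distance -/

theorem seqCost_eq_rpow {p : ℝ} (hp : 1 ≤ p) (ℓ : ℕ) : seqCost p ℓ = (ℓ : ℝ) ^ (1 / p) := by
  unfold seqCost
  split_ifs with h
  · have : 1 / p ≠ 0 := by positivity
    rw [h, Nat.cast_zero, Real.zero_rpow this]
  · rfl

theorem seqCost_nonneg (p : ℝ) (ℓ : ℕ) : 0 ≤ seqCost p ℓ := by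
  unfold seqCost
  split_ifs <;> positivity

theorem seqCost_mono {p : ℝ} (hp : 1 ≤ p) : Monotone (seqCost p) := by
  intro a b h
  rw [seqCost_eq_rpow hp, seqCost_eq_rpow hp]
  have : (a : ℝ) ≤ b := by exact_mod_cast h
  have : 0 ≤ 1 / p := by positivity
  gcongr

theorem seqCost_add_le {p : ℝ} (hp : 1 ≤ p) (a b : ℕ) :
    seqCost p (a + b) ≤ seqCost p a + seqCost p b := by
  rw [seqCost_eq_rpow hp, seqCost_eq_rpow hp, seqCost_eq_rpow hp, Nat.cast_add]
  refine Real.rpow_add_le_add_rpow (Nat.cast_nonneg a) (Nat.cast_nonneg b) (by positivity) ?_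
  exact (div_le_one (by linarith)).2 hp

theorem eq_zero_of_seqCost_eq_zero {p : ℝ} {ℓ : ℕ} (h : seqCost p ℓ = 0) : ℓ = 0 := by
  by_contra hl
  rw [seqCost, if_neg hl] at h
  have : (0 : ℝ) < ℓ := by exact_mod_cast Nat.pos_of_ne_zero hl
  exact (Real.rpow_pos_of_pos this _).ne' h

/-- The costs form the image of a nonempty set of natural numbers under a monotone function. -/
theorem isLeast_reflectionDist {p : ℝ} (hp : 1 ≤ p) (V W : ZigzagModule F n) :
    IsLeast (costSet p V W) (reflectionDist p V W) := by
  classical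
  have hex : ∃ m : ℕ, ∃ R R' : List (Reflection n), Precsim (applySeq R V) W ∧
      Precsim (applySeq R' W) V ∧ m = max R.length R'.length := by
    obtain ⟨R, hR⟩ := V.exists_applySeq_subsingleton
    obtain ⟨R', hR'⟩ := W.exists_applySeq_subsingleton
    exact ⟨_, R, R', precsim_of_subsingleton hR W, precsim_of_subsingleton hR' V, rfl⟩
  obtain ⟨R, R', h, h', hm⟩ := Nat.find_spec hex
  have hl : IsLeast (costSet p V W) (seqCost p (Nat.find hex)) := by
    refine ⟨⟨R, R', h, h', ?_⟩, ?_⟩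
    · rw [hm, (seqCost_mono hp).map_max]
    · rintro t ⟨S, S', hS, hS', rfl⟩
      rw [← (seqCost_mono hp).map_max]
      exact seqCost_mono hp (Nat.find_min' hex ⟨S, S', hS, hS', rfl⟩)
  rw [reflectionDist, hl.csInf_eq]
  exact hl

theorem reflectionDist_nonneg {p : ℝ} (hp : 1 ≤ p) (V W : ZigzagModule F n) :
    0 ≤ reflectionDist p V W := by
  obtain ⟨R, R', -, -, h⟩ := (isLeast_reflectionDist hp V W).1
  rw [h]
  exact le_max_of_le_left (seqCost_nonneg p _)

theorem reflectionDist_eq_zero_iff {p : ℝ} (hp : 1 ≤ p) (V W : ZigzagModule F n) :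
    reflectionDist p V W = 0 ↔ SimS V W := by
  constructor
  · intro h
    obtain ⟨R, R', h1, h2, ht⟩ := (isLeast_reflectionDist hp V W).1
    rw [h] at ht
    have hR := eq_zero_of_seqCost_eq_zero
      (le_antisymm ((le_max_left _ _).trans ht.ge) (seqCost_nonneg p R.length))
    have hR' := eq_zero_of_seqCost_eq_zero
      (le_antisymm ((le_max_right _ _).trans ht.ge) (seqCost_nonneg p R'.length))
    rw [List.length_eq_zero_iff] at hR hR'
    subst hR hR'
    exact ⟨h1, h2⟩
  · intro h
    refine le_antisymm ((isLeast_reflectionDist hp V W).2 ⟨[], [], h.1, h.2, ?_⟩)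
      (reflectionDist_nonneg hp V W)
    simp [seqCost]

theorem simS_refl (V : ZigzagModule F n) : SimS V V :=
  ⟨V.precsim_removeSimple_self, V.precsim_removeSimple_self⟩

theorem reflectionDist_comm (p : ℝ) (V W : ZigzagModule F n) :
    reflectionDist p V W = reflectionDist p W V := by
  have h : ∀ V W : ZigzagModule F n, costSet p V W ⊆ costSet p W V := by
    rintro V W t ⟨R, R', h, h', rfl⟩
    exact ⟨R', R, h', h, max_comm _ _⟩
  rw [reflectionDist, reflectionDist, (h V W).antisymm (h W V)]

theorem reflectionDist_triangle {p : ℝ} (hp : 1 ≤ p) (V W U : ZigzagModule F n) :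
    reflectionDist p V U ≤ reflectionDist p V W + reflectionDist p W U := by
  obtain ⟨R, R', h1, h2, ht⟩ := (isLeast_reflectionDist hp V W).1
  obtain ⟨S, S', h3, h4, hs⟩ := (isLeast_reflectionDist hp W U).1
  refine ((isLeast_reflectionDist hp V U).2
    ⟨R ++ S, S' ++ R', h1.applySeq_append h3, h4.applySeq_append h2, rfl⟩).trans ?_
  rw [ht, hs, List.length_append, List.length_append]
  refine max_le ((seqCost_add_le hp _ _).trans ?_) ((seqCost_add_le hp _ _).trans ?_)
  · exact add_le_add (le_max_left _ _) (le_max_left _ _)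
  · rw [add_comm]
    exact add_le_add (le_max_right _ _) (le_max_right _ _)

theorem reflectionDist_congr {p : ℝ} (hp : 1 ≤ p) {V V' W W' : ZigzagModule F n}
    (hV : SimS V V') (hW : SimS W W') : reflectionDist p V W = reflectionDist p V' W' := by
  have h : ∀ {V V' W W' : ZigzagModule F n}, SimS V V' → SimS W W' →
      reflectionDist p V W ≤ reflectionDist p V' W' := by
    intro V V' W W' hV hW
    have h1 := reflectionDist_triangle hp V V' W
    have h2 := reflectionDist_triangle hp V' W' W
    rw [(reflectionDist_eq_zero_iff hp _ _).2 hV] at h1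
    rw [reflectionDist_comm p W' W, (reflectionDist_eq_zero_iff hp _ _).2 hW] at h2
    linarith
  exact le_antisymm (h hV hW) (h hV.symm hW.symm)

theorem equivalence_simS : Equivalence (SimS (F := F) (n := n)) where
  refl := simS_refl
  symm h := h.symm
  trans {V W U} h h' := by
    rw [← reflectionDist_eq_zero_iff le_rfl] at h h' ⊢
    have := reflectionDist_triangle le_rfl V W U
    exact le_antisymm (by linarith) (reflectionDist_nonneg le_rfl V U)

end ZigzagModule

theorem mainTheorem2 {F : Type u} [Field F] (n : ℕ) (p : ℝ) (hp : 1 ≤ p) :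
    -- the minimum that defines the distance exists
    (∀ V W : ZigzagModule F n,
      IsLeast (ZigzagModule.costSet p V W) (ZigzagModule.reflectionDist p V W)) ∧
    -- the distance is a pseudometric
    (∃ P : PseudoMetricSpace (ZigzagModule F n), ∀ V W : ZigzagModule F n,
      P.dist V W = ZigzagModule.reflectionDist p V W) ∧
    -- it vanishes exactly on equivalent pairs
    (∀ V W : ZigzagModule F n,
      ZigzagModule.reflectionDist p V W = 0 ↔ ZigzagModule.SimS V W) ∧
    -- it induces a metric on the quotient
    (∃ (hS : Equivalence (ZigzagModule.SimS (F := F) (n := n)))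
      (M : MetricSpace (Quotient (Setoid.mk ZigzagModule.SimS hS))),
      ∀ V W : ZigzagModule F n,
        M.dist (Quotient.mk (Setoid.mk ZigzagModule.SimS hS) V)
          (Quotient.mk (Setoid.mk ZigzagModule.SimS hS) W) =
            ZigzagModule.reflectionDist p V W) := by
  have hself : ∀ V : ZigzagModule F n, ZigzagModule.reflectionDist p V V = 0 := fun V =>
    (ZigzagModule.reflectionDist_eq_zero_iff hp V V).2 V.simS_refl
  refine ⟨ZigzagModule.isLeast_reflectionDist hp, ⟨?_, ?_⟩,
    ZigzagModule.reflectionDist_eq_zero_iff hp, ZigzagModule.equivalence_simS, ?_, ?_⟩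
  · exact
      { dist := ZigzagModule.reflectionDist p
        dist_self := hself
        dist_comm := ZigzagModule.reflectionDist_comm p
        dist_triangle := ZigzagModule.reflectionDist_triangle hp }
  · exact fun _ _ => rfl
  · exact
      { dist := Quotient.lift₂ (ZigzagModule.reflectionDist p) fun _ _ _ _ hV hW =>
          ZigzagModule.reflectionDist_congr hp hV hW
        dist_self := Quotient.ind hself
        dist_comm := Quotient.ind₂ (ZigzagModule.reflectionDist_comm p)
        dist_triangle := fun a b c => Quotient.inductionOn₃ a b c
          (ZigzagModule.reflectionDist_triangle hp)
        eq_of_dist_eq_zero := fun {a b} => Quotient.inductionOn₂ a b fun V W h =>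
          Quotient.sound ((ZigzagModule.reflectionDist_eq_zero_iff hp V W).1 h) }
  · exact fun _ _ => rfl
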